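/- Let $T\colon[0,1]\to[0,1]$ be the tent map, $T(x)=2x$ for $0\le x\le \tfrac12$ and $T(x)=2-2x$ for $\tfrac12<x\le 1$. Call a subset of $[0,1]$ a $\boldsymbol{\Sigma}^0_3$-set if it is a countable union of $G_\delta$-sets and a $\boldsymbol{\Pi}^0_3$-set if its complement is a $\boldsymbol{\Sigma}^0_3$-set; call it $\boldsymbol{\Pi}^0_3$-complete if it is in $\boldsymbol{\Pi}^0_3\setminus\boldsymbol{\Sigma}^0_3$, and $\boldsymbol{\Sigma}^0_3$-complete if it is in $\boldsymbol{\Sigma}^0_3\setminus\boldsymbol{\Pi}^0_3$. A point $x\in[0,1]$ generates a Borel probability measure $\mu$ on $[0,1]$ if $$\lim_{N\to\infty}\frac1N\,\bigl|\{0\le n<N: T^n(x)\in J\}\bigr|=\mu(J)$$ for every interval $J\subseteq[0,1]$ with $\mu(\partial J)=0$, where $\partial J$ is the boundary in $[0,1]$; the statistical basin of $\mu$ is the set of all points that generate $\mu$. A point $x$ is irregular if there is a continuous $f\colon[0,1]\to\mathbb{R}$ for which $\frac1N\sum_{n<N}f(T^n(x))$ does not converge as $N\to\infty$. (1) For every $T$-invariant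 Borel probability measure $\mu$ on $[0,1]$, the statistical basin of $\mu$ is $\boldsymbol{\Pi}^0_3$-complete. (2) A point is irregular if and only if its tent map expansion is irregular, that is, if and only if there are $k\ge 0$ and $a_1,\dots,a_k\in\{0,1\}$ such that the frequency of the times $n<N$ with $T^{n+i-1}(x)\in I_{a_i}$ for all $1\le i\le k$, where $I_0=[0,\tfrac12)$ and $I_1=[\tfrac12,1)$, does not converge as $N\to\infty$. The set of irregular points is $\boldsymbol{\Sigma}^0_3$-complete. (3) In particular, $T$ is continuous, the Dirac mass $\delta_0$ at $0$ is $T$-invariant, and the statistical basin of $\delta_0$ is $\boldsymbol{\Pi}^0_3$-complete; so there is a continuous map $[0,1]\to[0,1]$ with an invariant Borel probability measure whose set of generic points is $\boldsymbol{\Pi}^0_3$-complete. -/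

import Mathlib

open Filter Topology MeasureTheory

noncomputable section

/-- The tent map of the unit interval: `x ↦ 2 x` on `[0, 1/2]` and `x ↦ 2 - 2 x` on `(1/2, 1]`. -/
def tentMap (x : unitInterval) : unitInterval :=
  ⟨if (x : ℝ) ≤ 1 / 2 then 2 * (x : ℝ) else 2 - 2 * (x : ℝ), by
    have h0 := x.2.1
    have h1 := x.2.2
    split_ifs with h
    · constructor <;> linarith
    · constructor <;> linarith⟩

open Classical in
/-- The relative number of times `n < N` at which the orbit `x, T x, T² x, …` is in `s`. -/
def visitFrequency {X : Type*} (T : X → X) (s : Set X) (x : X) (N : ℕ) : ℝ :=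
  ((Finset.range N).filter (fun n => T^[n] x ∈ s)).card / (N : ℝ)

/-- The point `x` generates `μ` under `T`: the orbit of `x` is uniformly distributed with respect
to `μ`, that is, it visits every interval with `μ`-null boundary with a limiting frequency equal
to the measure of that interval. (The intervals of `[0, 1]` are its order connected subsets, and
the boundary is the one in the space `[0, 1]`.) -/
def Generates (T : unitInterval → unitInterval) (μ : Measure unitInterval)
    (x : unitInterval) : Prop :=
  ∀ s : Set unitInterval, s.OrdConnected → μ (frontier s) = 0 →
    Tendsto (visitFrequency T s x) atTop (𝓝 (μ.real s))

/-- The statistical basin of `μ`: the set of points that generate `μ`. -/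
def statisticalBasin (T : unitInterval → unitInterval) (μ : Measure unitInterval) :
    Set unitInterval :=
  {x | Generates T μ x}

/-- The irregular points of `T`: the time averages of some continuous function along the orbit
do not converge. -/
def irregularSet (T : unitInterval → unitInterval) : Set unitInterval :=
  {x | ∃ f : C(unitInterval, ℝ), ¬ ∃ l : ℝ,
    Tendsto (fun N : ℕ => birkhoffAverage ℝ T f N x) atTop (𝓝 l)}

/-- The two digit intervals `[0, 1/2)` (digit `false`) and `[1/2, 1)` (digit `true`) of the
tent map. -/
def tentDigitInterval (d : Bool) : Set unitInterval :=
  if d then {x | 1 / 2 ≤ (x : ℝ) ∧ (x : ℝ) < 1} else {x | (x : ℝ) < 1 / 2}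

/-- The fundamental interval of a block `w` of digits: the points whose tent map expansion (their
itinerary with respect to the two digit intervals) starts with `w`. -/
def tentFundamentalInterval (w : List Bool) : Set unitInterval :=
  {x | ∀ i : Fin w.length, tentMap^[i] x ∈ tentDigitInterval (w.get i)}

/-- The points with an irregular tent map expansion: some block `w` of digits does not occur in
the expansion with a limiting frequency. (The block `w` occurs at position `n` exactly when the
orbit is in the fundamental interval of `w` at time `n`.) -/
def tentIrregularExpansionSet : Set unitInterval :=
  {x | ∃ w : List Bool, ¬ ∃ l : ℝ,
    Tendsto (visitFrequency tentMap (tentFundamentalInterval w) x) atTop (𝓝 l)}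

/-- `Σ⁰₃` subsets of a metrizable space: the countable unions of `G_δ` sets. -/
def IsSigmaZeroThree {X : Type*} [TopologicalSpace X] (s : Set X) : Prop :=
  ∃ A : ℕ → Set X, (∀ n, IsGδ (A n)) ∧ s = ⋃ n, A n

/-- `Π⁰₃` sets: the complements of the `Σ⁰₃` sets, that is, in a metrizable space, the countable
intersections of `F_σ` sets. -/
def IsPiZeroThree {X : Type*} [TopologicalSpace X] (s : Set X) : Prop :=
  IsSigmaZeroThree sᶜ

/-- `Σ⁰₃`-complete sets: those in `Σ⁰₃ \ Π⁰₃`. -/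
def IsSigmaZeroThreeComplete {X : Type*} [TopologicalSpace X] (s : Set X) : Prop :=
  IsSigmaZeroThree s ∧ ¬ IsPiZeroThree s

/-- `Π⁰₃`-complete sets: those in `Π⁰₃ \ Σ⁰₃`. -/
def IsPiZeroThreeComplete {X : Type*} [TopologicalSpace X] (s : Set X) : Prop :=
  IsPiZeroThree s ∧ ¬ IsSigmaZeroThree s

end

/-! Both hardness claims come from one reduction. The set `divergentSequences` is not Σ⁰₃, by a
Baire category and fusion argument (`not_isSigmaZeroThree_divergentSequences`). For each invariant
`μ`, `exists_reduction` gives a continuous map from integer sequences to the interval sending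
divergent sequences to points generating `μ` and all others to irregular points. Thus the divergent
sequences are the preimage both of the basin and of the complement of the irregular set.

To build the map, take a digit sequence `w` generating `μ` and write a constant digit `c` into the
first `2 ^ (n - (a n + 1))` places of each block `[2 ^ n, 2 ^ (n + 1))`. If `a` diverges, the
changes have density zero and no time average is affected. Otherwise a fixed proportion of
infinitely many blocks follows the fixed point coded by `c`, while the second half of every block
follows `w`. A limiting average would then equal two values, which the choice of `c` makes
different.

That `μ`, ergodic or not, has a generating point (`exists_generic_digits`) is a greedy argument.
Weak convergence is encoded by averages in a Hilbert space; the next orbit piece is chosen so that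
its deviation has nonpositive inner product with the deviation accumulated so far. Squared norms
then add at most like orthogonal vectors, and itineraries of the pieces can be concatenated freely.

The upper bounds hold because a dense sequence of continuous functions suffices as tests. Intervals
and blocks of digits are linked to continuous functions by compactness of the probability measures:
limits of empirical measures are invariant, invariant measures do not charge the boundaries of
fundamental intervals, and their values on these intervals determine them. -/

/-! ### The divergent sequences are not Σ⁰₃ -/

/-- The set of integer sequences which tend to infinity. -/
def divergentSequences : Set (ℕ → ℕ) := {a | Tendsto a atTop atTop}

/-- The sequences which agree with `a` before `m` and are at least `k` from `m` on. -/
def restrictedCylinder (a : ℕ → ℕ) (m k : ℕ) : Set (ℕ → ℕ) :=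
  {b | (∀ i < m, b i = a i) ∧ ∀ i, m ≤ i → k ≤ b i}

theorem exists_mem_forall_lt_eq_of_isOpen {U : Set (ℕ → ℕ)} (hU : IsOpen U) {x : ℕ → ℕ}
    (hx : x ∈ U) : ∃ m, ∀ y : ℕ → ℕ, (∀ i < m, y i = x i) → y ∈ U := by
  obtain ⟨I, u, hu, hsub⟩ := isOpen_pi_iff.1 hU x hx
  obtain ⟨m, hm⟩ := I.exists_nat_subset_range
  refine ⟨m, fun y hy => hsub fun i hi => ?_⟩
  rw [hy i (Finset.mem_range.1 (hm hi))]
  exact (hu i hi).2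

theorem isGδ_frequently_eq_zero : IsGδ {b : ℕ → ℕ | ∃ᶠ i in atTop, b i = 0} := by
  have h : {b : ℕ → ℕ | ∃ᶠ i in atTop, b i = 0} = ⋂ n, ⋃ i ≥ n, {b : ℕ → ℕ | b i = 0} := by
    ext b; simp [frequently_atTop]
  rw [h]
  refine .iInter_of_isOpen fun n => isOpen_biUnion fun i _ => ?_
  exact (isOpen_discrete {0}).preimage (f := fun b : ℕ → ℕ => b i) (continuous_apply i)

theorem dense_frequently_eq_zero : Dense {b : ℕ → ℕ | ∃ᶠ i in atTop, b i = 0} := by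
  refine dense_iff_inter_open.2 fun U hU ⟨x, hx⟩ => ?_
  obtain ⟨m, hm⟩ := exists_mem_forall_lt_eq_of_isOpen hU hx
  refine ⟨fun i => if i < m then x i else 0, hm _ fun i hi => if_pos hi, ?_⟩
  exact (eventually_ge_atTop m).frequently.mono fun i hi => if_neg (not_lt.2 hi)

/-- A `G_δ` set of divergent sequences misses some restricted cylinder inside each
restricted cylinder. -/
theorem exists_restrictedCylinder_disjoint {A : Set (ℕ → ℕ)} (hA : IsGδ A)
    (hAd : A ⊆ divergentSequences) (a : ℕ → ℕ) (m k : ℕ) :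
    ∃ b ∈ restrictedCylinder a m k, ∃ m' > m, Disjoint (restrictedCylinder b m' k) A := by
  by_contra! H
  -- `φ` parametrizes the restricted cylinder by Baire space. If the claim fails, `φ ⁻¹' A` is a
  -- dense `G_δ`, so by Baire it contains some `b` with infinitely many zeros; then `φ b ∈ A` takes
  -- the value `k` infinitely often and does not diverge.
  let φ : (ℕ → ℕ) → ℕ → ℕ := fun b i => if i < m then a i else k + b i
  have hφ : Continuous φ := by
    refine continuous_pi fun i => ?_
    by_cases hi : i < m
    · simpa [φ, hi] using continuous_const
    · simp only [φ, hi, if_false]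
      fun_prop
  have hd : Dense (φ ⁻¹' A) := by
    refine dense_iff_inter_open.2 fun U hU ⟨x, hx⟩ => ?_
    obtain ⟨n, hn⟩ := exists_mem_forall_lt_eq_of_isOpen hU hx
    obtain ⟨y, hy, hyA⟩ := Set.not_disjoint_iff.1 (H (φ x)
      ⟨fun i hi => if_pos hi, fun i hi => by simp [φ, not_lt.2 hi]⟩ (max n (m + 1)) (by lia))
    have hyk : ∀ i, m ≤ i → k ≤ y i := fun i hi => by
      rcases lt_or_ge i (max n (m + 1)) with h | h
      · rw [hy.1 i h]; simp [φ, not_lt.2 hi]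
      · exact hy.2 i h
    have hφy : φ (fun i => y i - k) = y := by
      funext i
      by_cases hi : i < m
      · simp only [φ, hi, if_true]
        rw [hy.1 i (by lia)]
        simp [φ, hi]
      · have := hyk i (by lia)
        simp only [φ, hi, if_false]
        lia
    -- agreement with `x` is only clear from `m` on, so the first entries are copied
    refine ⟨fun i => if i < m then x i else y i - k, hn _ fun i hi => ?_, ?_⟩
    · by_cases him : i < m
      · simp [him]
      · simp only [him, if_false]
        rw [hy.1 i (by lia)]
        simp [φ, him]
    · have : φ (fun i => if i < m then x i else y i - k) = φ (fun i => y i - k) := by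
        funext i
        by_cases hi : i < m <;> simp [φ, hi]
      rw [Set.mem_preimage, this, hφy]
      exact hyA
  obtain ⟨b, hbA, hb⟩ := ((hd.inter_of_Gδ (hA.preimage hφ) isGδ_frequently_eq_zero
    dense_frequently_eq_zero).nonempty)
  have hdiv : ∀ᶠ i in atTop, k + 1 ≤ φ b i := (hAd hbA).eventually_ge_atTop (k + 1)
  obtain ⟨i, hi0, hi1, hi2⟩ := (hb.and_eventually (hdiv.and (eventually_ge_atTop m))).exists
  simp only [φ, not_lt.2 hi2, if_false] at hi1
  lia

/-- Fusion: stage `k` fixes a longer prefix after which the lower bound `k` already forces a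
sequence out of `A k`. Later stages respect this bound and raise it, so the limit diverges but
avoids every `A k`. -/
theorem not_isSigmaZeroThree_divergentSequences : ¬ IsSigmaZeroThree divergentSequences := by
  rintro ⟨A, hA, hAU⟩
  have hsub : ∀ n, A n ⊆ divergentSequences := fun n => hAU ▸ Set.subset_iUnion A n
  choose f hf g hg hdis using fun k (p : (ℕ → ℕ) × ℕ) =>
    exists_restrictedCylinder_disjoint (hA k) (hsub k) p.1 p.2 k
  let s : ℕ → (ℕ → ℕ) × ℕ := fun n => Nat.rec (fun _ => 0, 0) (fun k p => (f k p, g k p)) n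
  have hs1 : ∀ k, (s (k + 1)).1 ∈ restrictedCylinder (s k).1 (s k).2 k := fun k => hf k (s k)
  have hs2 : ∀ k, (s k).2 < (s (k + 1)).2 := fun k => hg k (s k)
  have hmono : StrictMono fun k => (s k).2 := strictMono_nat_of_lt_succ hs2
  have hagree : ∀ k j, k ≤ j → ∀ i < (s k).2, (s j).1 i = (s k).1 i := by
    intro k j hkj
    induction j, hkj using Nat.le_induction with
    | base => simp
    | succ j hkj ih =>
      intro i hi
      rw [(hs1 j).1 i (hi.trans_le (hmono.monotone hkj)), ih i hi]
  have hlarge : ∀ k j, k ≤ j → ∀ i, (s k).2 ≤ i → i < (s j).2 → k ≤ (s j).1 i := by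
    intro k j hkj
    induction j, hkj using Nat.le_induction with
    | base => intro i h1 h2; lia
    | succ j hkj ih =>
      intro i h1 h2
      rcases lt_or_ge i (s j).2 with h | h
      · rw [(hs1 j).1 i h]; exact ih i h1 h
      · exact hkj.trans ((hs1 j).2 i h)
  -- Entry `i` is final from stage `i + 1` on, because prefix lengths increase strictly.
  let x : ℕ → ℕ := fun i => (s (i + 1)).1 i
  have hx : ∀ k, ∀ i < (s k).2, x i = (s k).1 i := by
    intro k i hi
    have hi' : i < (s (i + 1)).2 := hmono.le_apply (x := i + 1)
    rcases le_total k (i + 1) with h | h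
    · exact hagree k _ h i hi
    · exact (hagree _ k h i hi').symm
  have hxk : ∀ k i, (s k).2 ≤ i → k ≤ x i := by
    intro k i hi
    have h1 : k ≤ i := (hmono.le_apply (x := k)).trans hi
    exact hlarge k (i + 1) (by lia) i hi (hmono.le_apply (x := i + 1))
  have hxd : x ∈ divergentSequences :=
    tendsto_atTop.2 fun k => (eventually_ge_atTop (s k).2).mono fun i hi => hxk k i hi
  rw [hAU] at hxd
  obtain ⟨k, hk⟩ := Set.mem_iUnion.1 hxd
  refine Set.disjoint_left.1 (hdis k (s k)) ⟨fun i hi => hx (k + 1) i hi, fun i hi => ?_⟩ hk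
  exact (Nat.le_succ k).trans (hxk (k + 1) i hi)

/-! ### Continuous preimages and first facts on the tent map -/

theorem IsSigmaZeroThree.preimage {X Y : Type*} [TopologicalSpace X] [TopologicalSpace Y]
    {s : Set Y} (hs : IsSigmaZeroThree s) {f : X → Y} (hf : Continuous f) :
    IsSigmaZeroThree (f ⁻¹' s) := by
  obtain ⟨A, hA, rfl⟩ := hs
  exact ⟨fun n => f ⁻¹' A n, fun n => (hA n).preimage hf, Set.preimage_iUnion⟩

theorem continuous_tentMap : Continuous tentMap := by
  refine Continuous.subtype_mk ?_ _
  refine Continuous.if_le (by fun_prop) (by fun_prop) (by fun_prop) (by fun_prop) ?_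
  intro x hx
  rw [hx]; norm_num

theorem tentMap_zero : tentMap 0 = 0 := by
  ext; simp [tentMap]

theorem dist_le_one_unitInterval (x y : unitInterval) : dist x y ≤ 1 := by
  rw [Subtype.dist_eq, Real.dist_eq, abs_sub_le_iff]
  constructor <;> linarith [x.2.1, x.2.2, y.2.1, y.2.2]

/-! ### Symbolic coding -/

/-- The two inverse branches of the tent map. -/
noncomputable def tentBranch (d : Bool) (y : unitInterval) : unitInterval :=
  ⟨if d then 1 - (y : ℝ) / 2 else (y : ℝ) / 2, by
    have h0 := y.2.1
    have h1 := y.2.2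
    split_ifs <;> constructor <;> linarith⟩

theorem dist_tentBranch (d : Bool) (y z : unitInterval) :
    dist (tentBranch d y) (tentBranch d z) = dist y z / 2 := by
  simp only [Subtype.dist_eq, Real.dist_eq, tentBranch]
  cases d
  · simp [← sub_div, abs_div]
  · simp only [if_true]
    rw [show 1 - (y : ℝ) / 2 - (1 - (z : ℝ) / 2) = -(((y : ℝ) - z) / 2) by ring, abs_neg, abs_div]
    simp

theorem continuous_tentBranch (d : Bool) : Continuous (tentBranch d) := by
  refine Continuous.subtype_mk ?_ _
  cases d <;> simp <;> fun_prop

theorem tentMap_tentBranch (d : Bool) (y : unitInterval) : tentMap (tentBranch d y) = y := by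
  have h0 := y.2.1
  have h1 := y.2.2
  ext
  cases d
  · have : (y : ℝ) / 2 ≤ 1 / 2 := by linarith
    simp only [tentMap, tentBranch, Bool.false_eq_true, if_false, this, if_true]
    ring
  · simp only [tentMap, tentBranch, if_true]
    split_ifs with h
    · have : (y : ℝ) = 1 := by linarith
      rw [this]; norm_num
    · ring

theorem tentBranch_tentMap (x : unitInterval) :
    tentBranch (decide (1 / 2 ≤ (x : ℝ))) (tentMap x) = x := by
  ext
  by_cases h : 1 / 2 ≤ (x : ℝ)
  · simp only [tentBranch, tentMap, h, decide_true, if_true]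
    split_ifs with h'
    · have : (x : ℝ) = 1 / 2 := le_antisymm h' h
      rw [this]; norm_num
    · ring
  · have h' : (x : ℝ) ≤ 1 / 2 := by linarith
    simp only [tentBranch, tentMap, h, decide_false, h', if_true, Bool.false_eq_true, if_false]
    ring

/-- The image of `0` under the first `n` branches prescribed by a digit sequence. -/
noncomputable def tentCodeApprox : ℕ → (ℕ → Bool) → unitInterval
  | 0, _ => 0
  | n + 1, w => tentBranch (w 0) (tentCodeApprox n fun i => w (i + 1))

/-- Each branch halves distances. The bound is left as `2 / 2 / 2 ^ n` to fit
`cauchySeq_of_le_geometric_two`. -/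
theorem dist_tentCodeApprox_succ (n : ℕ) (w : ℕ → Bool) :
    dist (tentCodeApprox n w) (tentCodeApprox (n + 1) w) ≤ 2 / 2 / 2 ^ n := by
  induction n generalizing w with
  | zero => simpa using dist_le_one_unitInterval _ _
  | succ n ih =>
    rw [tentCodeApprox, tentCodeApprox, dist_tentBranch]
    calc _ ≤ (2 / 2 / 2 ^ n : ℝ) / 2 := by gcongr; exact ih _
      _ = _ := by rw [pow_succ]; ring

theorem exists_tendsto_tentCodeApprox (w : ℕ → Bool) :
    ∃ x, Tendsto (fun n => tentCodeApprox n w) atTop (𝓝 x) :=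
  cauchySeq_tendsto_of_complete
    (cauchySeq_of_le_geometric_two fun n => dist_tentCodeApprox_succ n w)

/-- The point with a given digit sequence. -/
noncomputable def tentCode (w : ℕ → Bool) : unitInterval :=
  (exists_tendsto_tentCodeApprox w).choose

theorem tendsto_tentCodeApprox (w : ℕ → Bool) :
    Tendsto (fun n => tentCodeApprox n w) atTop (𝓝 (tentCode w)) :=
  (exists_tendsto_tentCodeApprox w).choose_spec

theorem tentCode_eq (w : ℕ → Bool) :
    tentCode w = tentBranch (w 0) (tentCode fun i => w (i + 1)) := by
  refine tendsto_nhds_unique ((tendsto_add_atTop_iff_nat 1).2 (tendsto_tentCodeApprox w)) ?_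
  exact ((continuous_tentBranch (w 0)).tendsto _).comp (tendsto_tentCodeApprox _)

theorem tentMap_tentCode (w : ℕ → Bool) : tentMap (tentCode w) = tentCode fun i => w (i + 1) := by
  rw [tentCode_eq, tentMap_tentBranch]

theorem iterate_tentMap_tentCode (n : ℕ) (w : ℕ → Bool) :
    tentMap^[n] (tentCode w) = tentCode fun i => w (i + n) := by
  induction n generalizing w with
  | zero => rfl
  | succ n ih =>
    rw [Function.iterate_succ_apply, tentMap_tentCode, ih]
    simp only [add_assoc]

theorem dist_tentCode_of_head_eq {v w : ℕ → Bool} (h : v 0 = w 0) :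
    dist (tentCode v) (tentCode w) =
      dist (tentCode fun i => v (i + 1)) (tentCode fun i => w (i + 1)) / 2 := by
  rw [tentCode_eq v, tentCode_eq w, h, dist_tentBranch]

theorem dist_tentCode_le {v w : ℕ → Bool} {k : ℕ} (h : ∀ i < k, v i = w i) :
    dist (tentCode v) (tentCode w) ≤ (1 / 2) ^ k := by
  induction k generalizing v w with
  | zero => simpa using dist_le_one_unitInterval _ _
  | succ k ih =>
    rw [dist_tentCode_of_head_eq (h 0 (by lia)), pow_succ]
    have := ih (v := fun i => v (i + 1)) (w := fun i => w (i + 1)) fun i hi => h (i + 1) (by lia)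
    linarith

theorem continuous_tentCode : Continuous tentCode := by
  refine continuous_iff_continuousAt.2 fun w => Metric.tendsto_nhds.2 fun ε hε => ?_
  obtain ⟨k, hk⟩ := exists_pow_lt_of_lt_one hε (by norm_num : (1 / 2 : ℝ) < 1)
  have : ∀ᶠ v in 𝓝 w, ∀ i < k, v i = w i := by
    refine (Set.finite_Iio k).eventually_all.2 fun i _ => ?_
    exact ((continuous_apply i).tendsto w).eventually (IsOpen.mem_nhds (isOpen_discrete {w i}) rfl)
  exact this.mono fun v hv => (dist_tentCode_le hv).trans_lt hk

/-- The sequence recording whether the points of the orbit are at least `1 / 2`. -/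
noncomputable def tentItinerary (x : unitInterval) (n : ℕ) : Bool :=
  decide (1 / 2 ≤ ((tentMap^[n] x : unitInterval) : ℝ))

theorem tentItinerary_tentMap (x : unitInterval) :
    tentItinerary (tentMap x) = fun i => tentItinerary x (i + 1) := rfl

theorem tentCode_tentItinerary (x : unitInterval) : tentCode (tentItinerary x) = x := by
  have h : ∀ (n : ℕ) (x : unitInterval), dist (tentCode (tentItinerary x)) x ≤ (1 / 2) ^ n := by
    intro n
    induction n with
    | zero => intro x; simpa using dist_le_one_unitInterval _ _
    | succ n ih =>
      intro x
      have hx := dist_tentBranch (decide (1 / 2 ≤ (x : ℝ))) (tentCode (tentItinerary (tentMap x)))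
        (tentMap x)
      rw [tentBranch_tentMap] at hx
      rw [tentCode_eq, ← tentItinerary_tentMap]
      refine hx.le.trans ?_
      rw [pow_succ]
      linarith [ih (tentMap x)]
  refine dist_le_zero.1 (ge_of_tendsto' (tendsto_pow_atTop_nhds_zero_of_lt_one
    (by norm_num : (0 : ℝ) ≤ 1 / 2) (by norm_num)) fun n => h n x)

/-! ### Averages of sequences -/

/-- Errors shrink by half going backwards in time: where digits agree, the distance now is half the
distance one step later. Summing, half of the left side absorbs itself. The induction keeps the
final term `e N`, which becomes the `1`. -/
theorem sum_range_le_of_le_half {e h : ℕ → ℝ} {N : ℕ} (h0 : ∀ n, 0 ≤ e n) (h1 : ∀ n, e n ≤ 1)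
    (hh : ∀ n < N, e n ≤ h n + e (n + 1) / 2) :
    ∑ n ∈ Finset.range N, e n ≤ 2 * ∑ n ∈ Finset.range N, h n + 1 := by
  suffices ∑ n ∈ Finset.range N, e n ≤ 2 * ∑ n ∈ Finset.range N, h n + e N by
    linarith [h1 N]
  induction N with
  | zero => simpa using h0 0
  | succ N ih =>
    rw [Finset.sum_range_succ, Finset.sum_range_succ]
    linarith [ih fun n hn => hh n (by lia), hh N (by lia)]

theorem tendsto_average_zero_of_le_half {e h : ℕ → ℝ} (h0 : ∀ n, 0 ≤ e n) (h1 : ∀ n, e n ≤ 1)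
    (hh : ∀ n, e n ≤ h n + e (n + 1) / 2)
    (hlim : Tendsto (fun N : ℕ => (∑ n ∈ Finset.range N, h n) / (N : ℝ)) atTop (𝓝 0)) :
    Tendsto (fun N : ℕ => (∑ n ∈ Finset.range N, e n) / (N : ℝ)) atTop (𝓝 0) := by
  have h2 : Tendsto (fun N : ℕ => 2 * ((∑ n ∈ Finset.range N, h n) / (N : ℝ)) + 1 / (N : ℝ)) atTop
      (𝓝 0) := by
    simpa using (hlim.const_mul 2).add (tendsto_const_div_atTop_nhds_zero_nat (1 : ℝ))
  refine squeeze_zero (fun N => div_nonneg (Finset.sum_nonneg fun n _ => h0 n) N.cast_nonneg)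
    (fun N => ?_) h2
  rw [← mul_div_assoc, ← add_div]
  gcongr
  exact sum_range_le_of_le_half h0 h1 fun n _ => hh n

/-- Orbits which are close on average have the same time averages. -/
theorem tendsto_average_sub_of_tendsto_average_dist {X : Type*} [PseudoMetricSpace X]
    [CompactSpace X] (f : C(X, ℝ)) {u v : ℕ → X}
    (h : Tendsto (fun N : ℕ => (∑ n ∈ Finset.range N, dist (u n) (v n)) / (N : ℝ)) atTop (𝓝 0)) :
    Tendsto (fun N : ℕ => (∑ n ∈ Finset.range N, (f (u n) - f (v n))) / (N : ℝ)) atTop (𝓝 0) := by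
  rw [Metric.tendsto_atTop]
  intro ε hε
  obtain ⟨δ, hδ, hf⟩ := Metric.uniformContinuous_iff.1
    (CompactSpace.uniformContinuous_of_continuous f.continuous) (ε / 2) (half_pos hε)
  -- Uniform continuity made linear: pairs at distance at least `δ` are charged the trivial bound `2
  -- * ‖f‖`, paid for by the distance.
  have hb : ∀ x y : X, |f x - f y| ≤ ε / 2 + 2 * ‖f‖ / δ * dist x y := by
    intro x y
    rcases lt_or_ge (dist x y) δ with hxy | hxy
    · have := (hf hxy).le
      rw [Real.dist_eq] at this
      have h2 : 0 ≤ 2 * ‖f‖ / δ * dist x y := by positivity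
      linarith
    · have h1 : 2 * ‖f‖ ≤ 2 * ‖f‖ / δ * dist x y := by
        rw [div_mul_eq_mul_div, le_div_iff₀ hδ]
        gcongr
      have h2 : |f x - f y| ≤ ‖f‖ + ‖f‖ :=
        (abs_sub (f x) (f y)).trans (add_le_add (f.norm_coe_le_norm x) (f.norm_coe_le_norm y))
      linarith
  have h3 := (h.const_mul (2 * ‖f‖ / δ)).eventually_lt_const (u := ε / 2) (by simpa using hε)
  obtain ⟨N₀, hN₀⟩ := eventually_atTop.1 h3
  refine ⟨N₀ + 1, fun N hN => ?_⟩
  have hNpos : (0 : ℝ) < N := by exact_mod_cast (by lia : 0 < N)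
  rw [dist_zero_right, Real.norm_eq_abs, abs_div, Nat.abs_cast, div_lt_iff₀ hNpos]
  have h4 := hN₀ N (by lia)
  rw [← mul_div_assoc, div_lt_iff₀ hNpos] at h4
  calc |∑ n ∈ Finset.range N, (f (u n) - f (v n))|
      ≤ ∑ n ∈ Finset.range N, |f (u n) - f (v n)| := Finset.abs_sum_le_sum_abs _ _
    _ ≤ ∑ n ∈ Finset.range N, (ε / 2 + 2 * ‖f‖ / δ * dist (u n) (v n)) :=
        Finset.sum_le_sum fun n _ => hb _ _
    _ = N * (ε / 2) + 2 * ‖f‖ / δ * ∑ n ∈ Finset.range N, dist (u n) (v n) := by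
        rw [Finset.sum_add_distrib, ← Finset.mul_sum]; simp
    _ < ε * N := by linarith

/-! ### Empirical measures -/

theorem isProbabilityMeasure_average_dirac {X : Type*} [MeasurableSpace X] (u : ℕ → X) (N : ℕ) :
    IsProbabilityMeasure
      (((N + 1 : ℕ) : ENNReal)⁻¹ • ∑ n ∈ Finset.range (N + 1), Measure.dirac (u n)) := by
  constructor
  simp only [Measure.smul_apply, Measure.finsetSum_apply, measure_univ, Finset.sum_const,
    Finset.card_range, nsmul_eq_mul, mul_one, smul_eq_mul]
  exact ENNReal.inv_mul_cancel (by simp) (ENNReal.natCast_ne_top _)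

/-- The uniform distribution on the first `N + 1` points of the orbit of `x`. -/
noncomputable def empiricalMeasure {X : Type*} [MeasurableSpace X] (T : X → X) (x : X) (N : ℕ) :
    ProbabilityMeasure X :=
  ⟨((N + 1 : ℕ) : ENNReal)⁻¹ • ∑ n ∈ Finset.range (N + 1), Measure.dirac (T^[n] x),
    isProbabilityMeasure_average_dirac _ N⟩

section Empirical

variable {X : Type*} [MeasurableSpace X] [MeasurableSingletonClass X] (T : X → X) (x : X)

theorem integral_empiricalMeasure (f : X → ℝ) (N : ℕ) :
    ∫ y, f y ∂(empiricalMeasure T x N : Measure X) = birkhoffAverage ℝ T f (N + 1) x := by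
  change ∫ y, f y ∂(((N + 1 : ℕ) : ENNReal)⁻¹ •
    ∑ n ∈ Finset.range (N + 1), Measure.dirac (T^[n] x)) = _
  rw [integral_smul_measure, integral_finsetSum_measure fun n _ => integrable_dirac (by simp)]
  simp only [integral_dirac, ENNReal.toReal_inv, ENNReal.toReal_natCast]
  rfl

theorem measureReal_empiricalMeasure (s : Set X) (N : ℕ) :
    (empiricalMeasure T x N : Measure X).real s = visitFrequency T s x (N + 1) := by
  classical
  change (((N + 1 : ℕ) : ENNReal)⁻¹ •
    ∑ n ∈ Finset.range (N + 1), Measure.dirac (T^[n] x)).real s = _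
  rw [measureReal_ennreal_smul_apply, measureReal_def, Measure.finsetSum_apply]
  simp only [Measure.dirac_apply, Set.indicator_apply, Pi.one_apply]
  rw [visitFrequency, Finset.sum_boole, div_eq_inv_mul]
  congr 2
  rw [ENNReal.toReal_inv, ENNReal.toReal_natCast]

end Empirical

section Weak

variable {X : Type*} [TopologicalSpace X] [CompactSpace X] [MeasurableSpace X] [BorelSpace X]
  [T1Space X] {T : X → X} {x : X} {l : Filter ℕ}

theorem tendsto_empiricalMeasure_iff {μ : ProbabilityMeasure X} :
    Tendsto (empiricalMeasure T x) l (𝓝 μ) ↔ ∀ f : C(X, ℝ),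
      Tendsto (fun N => birkhoffAverage ℝ T f (N + 1) x) l (𝓝 (∫ y, f y ∂(μ : Measure X))) := by
  rw [ProbabilityMeasure.tendsto_iff_forall_integral_tendsto]
  constructor
  · intro h f
    simpa [integral_empiricalMeasure] using h (BoundedContinuousFunction.mkOfCompact f)
  · intro h f
    simpa [integral_empiricalMeasure] using h f.toContinuousMap

omit [CompactSpace X] in
theorem tendsto_visitFrequency_of_tendsto_empiricalMeasure [HasOuterApproxClosed X]
    {μ : ProbabilityMeasure X} (h : Tendsto (empiricalMeasure T x) l (𝓝 μ)) {s : Set X}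
    (hs : (μ : Measure X) (frontier s) = 0) :
    Tendsto (fun N => visitFrequency T s x (N + 1)) l (𝓝 ((μ : Measure X).real s)) := by
  have := (ENNReal.tendsto_toReal (measure_ne_top (μ : Measure X) s)).comp
    (ProbabilityMeasure.tendsto_measure_of_null_frontier_of_tendsto' h hs)
  exact this.congr fun N => measureReal_empiricalMeasure T x s N

/-- Limits of empirical measures of a continuous map are invariant. -/
theorem measurePreserving_of_tendsto_empiricalMeasure [HasOuterApproxClosed X] [l.NeBot]
    (hl : l ≤ atTop) (hT : Continuous T) {μ : ProbabilityMeasure X}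
    (h : Tendsto (empiricalMeasure T x) l (𝓝 μ)) :
    MeasurePreserving T (μ : Measure X) (μ : Measure X) := by
  refine ⟨hT.measurable, ?_⟩
  have : IsProbabilityMeasure (Measure.map T (μ : Measure X)) :=
    Measure.isProbabilityMeasure_map hT.aemeasurable
  refine ext_of_forall_integral_eq_of_IsFiniteMeasure fun f => ?_
  rw [integral_map hT.aemeasurable f.continuous.aestronglyMeasurable]
  rw [tendsto_empiricalMeasure_iff] at h
  have h1 := h (f.toContinuousMap.comp ⟨T, hT⟩)
  have h2 := h f.toContinuousMap
  -- The sums of `f ∘ T` and `f` differ by two boundary terms only.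
  have h3 : Tendsto (fun N : ℕ => birkhoffAverage ℝ T (f.toContinuousMap.comp ⟨T, hT⟩) (N + 1) x -
      birkhoffAverage ℝ T f.toContinuousMap (N + 1) x) l (𝓝 0) := by
    have h4 : Tendsto (fun n : ℕ => birkhoffAverage ℝ T f n (T x) - birkhoffAverage ℝ T f n x)
        atTop (𝓝 0) :=
      tendsto_birkhoffAverage_apply_sub_birkhoffAverage (𝕜 := ℝ)
        (f.isBounded_range.subset (Set.range_subset_iff.2 fun n => ⟨_, rfl⟩))
    refine (((tendsto_add_atTop_iff_nat 1).2 h4).mono_left hl).congr fun N => ?_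
    congr 1
    simp only [birkhoffAverage, birkhoffSum]
    congr 1
    refine Finset.sum_congr rfl fun n _ => ?_
    simp [← Function.iterate_succ_apply, Function.iterate_succ_apply']
  exact sub_eq_zero.1 (tendsto_nhds_unique (h1.sub h2) h3)

-- Compactness of the space of probability measures; ultrafilters replace the extraction of
-- subsequences.
omit [T1Space X] in
theorem exists_tendsto_empiricalMeasure_ultrafilter [T2Space X] (u : Ultrafilter ℕ) :
    ∃ μ : ProbabilityMeasure X, Tendsto (empiricalMeasure T x) u (𝓝 μ) := by
  obtain ⟨μ, -, hμ⟩ := isCompact_univ.ultrafilter_le_nhds (u.map (empiricalMeasure T x)) (by simp)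
  exact ⟨μ, hμ⟩

/-- If the time averages of all continuous functions converge then the empirical measures
converge. -/
theorem exists_tendsto_empiricalMeasure [T2Space X]
    (h : ∀ f : C(X, ℝ), ∃ c : ℝ, Tendsto (fun N => birkhoffAverage ℝ T f N x) atTop (𝓝 c)) :
    ∃ μ : ProbabilityMeasure X, Tendsto (empiricalMeasure T x) atTop (𝓝 μ) := by
  obtain ⟨μ, hμ⟩ :=
    exists_tendsto_empiricalMeasure_ultrafilter (T := T) (x := x) (Ultrafilter.of atTop)
  refine ⟨μ, tendsto_empiricalMeasure_iff.2 fun f => ?_⟩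
  obtain ⟨c, hc⟩ := h f
  have hc' := (tendsto_add_atTop_iff_nat 1).2 hc
  rw [tendsto_nhds_unique (tendsto_empiricalMeasure_iff.1 hμ f)
    (hc'.mono_left (Ultrafilter.of_le atTop))]
  exact hc'

end Weak

/-! ### Fundamental intervals -/

theorem tentFundamentalInterval_nil : tentFundamentalInterval [] = Set.univ := by
  ext x; simp [tentFundamentalInterval]

theorem tentFundamentalInterval_cons (d : Bool) (w : List Bool) :
    tentFundamentalInterval (d :: w) =
      tentDigitInterval d ∩ tentMap ⁻¹' tentFundamentalInterval w := by
  ext x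
  exact Fin.forall_fin_succ

theorem mem_tentFundamentalInterval_ofFn {K : ℕ} (w : Fin K → Bool) (x : unitInterval) :
    x ∈ tentFundamentalInterval (List.ofFn w) ↔
      ∀ i : Fin K, tentMap^[i] x ∈ tentDigitInterval (w i) := by
  simp only [tentFundamentalInterval, Set.mem_ofPred_eq, Fin.forall_iff, List.length_ofFn,
    List.get_eq_getElem, List.getElem_ofFn]

/-- The tent map is monotone on each digit interval, reversing order on the second, so intervals
pull back to intervals there. This makes blocks admissible tests in `Generates`. -/
theorem ordConnected_tentFundamentalInterval (w : List Bool) :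
    (tentFundamentalInterval w).OrdConnected := by
  induction w with
  | nil => rw [tentFundamentalInterval_nil]; exact Set.ordConnected_univ
  | cons d w ih =>
    rw [tentFundamentalInterval_cons]
    refine Set.ordConnected_def.2 fun x hx y hy z hz => ?_
    have hxz : (x : ℝ) ≤ z := hz.1
    have hzy : (z : ℝ) ≤ y := hz.2
    cases d
    · have h1 : (x : ℝ) < 1 / 2 := by simpa [tentDigitInterval] using hx.1
      have h2 : (y : ℝ) < 1 / 2 := by simpa [tentDigitInterval] using hy.1
      refine ⟨by simp only [tentDigitInterval, Bool.false_eq_true, if_false, Set.mem_ofPred_eq];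
                 linarith, ih.out hx.2 hy.2 ⟨?_, ?_⟩⟩ <;>
      · rw [← Subtype.coe_le_coe]
        simp only [tentMap]
        split_ifs <;> linarith
    · have h1 : 1 / 2 ≤ (x : ℝ) ∧ (x : ℝ) < 1 := by simpa [tentDigitInterval] using hx.1
      have h2 : 1 / 2 ≤ (y : ℝ) ∧ (y : ℝ) < 1 := by simpa [tentDigitInterval] using hy.1
      refine ⟨by simp only [tentDigitInterval, if_true, Set.mem_ofPred_eq];
                 constructor <;> linarith, ih.out hy.2 hx.2 ⟨?_, ?_⟩⟩ <;>
      · rw [← Subtype.coe_le_coe]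
        simp only [tentMap]
        split_ifs <;> linarith

theorem frontier_tentDigitInterval_subset (d : Bool) :
    frontier (tentDigitInterval d) ⊆ {x | (x : ℝ) = 1 / 2} ∪ {1} := by
  have h1 : frontier {x : unitInterval | (x : ℝ) < 1 / 2} ⊆ {x | (x : ℝ) = 1 / 2} :=
    frontier_lt_subset_eq continuous_subtype_val continuous_const
  cases d
  · exact h1.trans Set.subset_union_left
  · have h2 : frontier {x : unitInterval | 1 / 2 ≤ (x : ℝ)} ⊆ {x | 1 / 2 = (x : ℝ)} :=
      frontier_le_subset_eq continuous_const continuous_subtype_val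
    have h3 : frontier {x : unitInterval | (x : ℝ) < 1} ⊆ {x | (x : ℝ) = 1} :=
      frontier_lt_subset_eq continuous_subtype_val continuous_const
    have h4 : tentDigitInterval true =
      {x : unitInterval | 1 / 2 ≤ (x : ℝ)} ∩ {x : unitInterval | (x : ℝ) < 1} := rfl
    rw [h4]
    refine (frontier_inter_subset _ _).trans (Set.union_subset_union ?_ ?_)
    · exact fun x hx => (h2 hx.1).symm
    · exact fun x hx => Subtype.ext (h3 hx.2)

section Invariant

variable {μ : Measure unitInterval} [IsProbabilityMeasure μ] (hμ : MeasurePreserving tentMap μ μ)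
include hμ

/-- The preimage of `0` is `{0, 1}`, so invariance leaves no mass for `1`. -/
theorem measure_singleton_one_of_invariant : μ {1} = 0 := by
  have h : tentMap ⁻¹' {0} = {0} ∪ {1} := by
    ext x
    simp only [Set.mem_preimage, Set.mem_singleton_iff, Set.mem_union, Subtype.ext_iff, tentMap]
    have h0 := x.2.1
    split_ifs with hx
    · constructor
      · intro h; left; change 2 * (x : ℝ) = 0 at h; change (x : ℝ) = 0; linarith
      · rintro (h | h)
        · change (x : ℝ) = 0 at h; change 2 * (x : ℝ) = 0; linarith
        · change (x : ℝ) = 1 at h; linarith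
    · constructor
      · intro h; right; change 2 - 2 * (x : ℝ) = 0 at h; change (x : ℝ) = 1; linarith
      · rintro (h | h)
        · change (x : ℝ) = 0 at h; linarith
        · change (x : ℝ) = 1 at h; change 2 - 2 * (x : ℝ) = 0; linarith
  have h1 := hμ.measure_preimage (measurableSet_singleton (0 : unitInterval)).nullMeasurableSet
  rw [h, measure_union (by simp) (measurableSet_singleton _)] at h1
  exact (ENNReal.add_right_inj (measure_ne_top _ _)).1 (h1.trans (add_zero _).symm)

theorem measure_eq_half_of_invariant : μ {x : unitInterval | (x : ℝ) = 1 / 2} = 0 := by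
  refine measure_mono_null (t := tentMap ⁻¹' {1}) (fun x hx => ?_) ?_
  · have hx' : (x : ℝ) = 1 / 2 := hx
    ext
    simp [tentMap, hx']
  · rw [hμ.measure_preimage (measurableSet_singleton _).nullMeasurableSet]
    exact measure_singleton_one_of_invariant hμ

/-- Boundary points are eventually mapped to `1/2` or `1`, which are null. Hence block frequencies
pass to every invariant weak limit. -/
theorem measure_frontier_tentFundamentalInterval (w : List Bool) :
    μ (frontier (tentFundamentalInterval w)) = 0 := by
  induction w with
  | nil => simp [tentFundamentalInterval_nil]
  | cons d w ih =>
    rw [tentFundamentalInterval_cons]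
    refine measure_mono_null ((frontier_inter_subset _ _).trans
      (Set.union_subset_union Set.inter_subset_left Set.inter_subset_right)) ?_
    refine measure_union_null ?_ ?_
    · exact measure_mono_null (frontier_tentDigitInterval_subset d) (measure_union_null
        (measure_eq_half_of_invariant hμ) (measure_singleton_one_of_invariant hμ))
    · refine measure_mono_null (continuous_tentMap.frontier_preimage_subset _) ?_
      rw [hμ.measure_preimage isClosed_frontier.measurableSet.nullMeasurableSet, ih]

/-- The two codings differ only along orbits that hit `1`: `tentItinerary` writes `true` there,
whereas `1` is in neither digit interval. Such orbits form a null set. -/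
theorem measure_tentItinerary_preimage {K : ℕ} (w : Fin K → Bool) :
    μ ((fun x (i : Fin K) => tentItinerary x i) ⁻¹' {w}) =
      μ (tentFundamentalInterval (List.ofFn w)) := by
  refine measure_congr ?_
  have h1 : ∀ᵐ x ∂μ, ∀ i : ℕ, tentMap^[i] x ≠ 1 := by
    refine ae_all_iff.2 fun i => ?_
    have := (hμ.iterate i).measure_preimage (measurableSet_singleton 1).nullMeasurableSet
    rw [measure_singleton_one_of_invariant hμ] at this
    exact measure_eq_zero_iff_ae_notMem.1 this
  filter_upwards [h1] with x hx
  refine propext ?_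
  change (fun i : Fin K => tentItinerary x i) = w ↔ x ∈ tentFundamentalInterval (List.ofFn w)
  rw [mem_tentFundamentalInterval_ofFn, funext_iff]
  refine forall_congr' fun i => ?_
  have hlt : ((tentMap^[i] x : unitInterval) : ℝ) < 1 :=
    lt_of_le_of_ne (tentMap^[i] x).2.2 fun h => hx i (Subtype.ext h)
  cases w i
  · simp [tentItinerary, tentDigitInterval]
  · simpa [tentItinerary, tentDigitInterval] using fun _ => hlt

end Invariant

theorem measurable_tentItinerary (i : ℕ) : Measurable fun x => tentItinerary x i := by
  refine measurable_to_bool ?_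
  have : IsClosed {x : unitInterval | 1 / 2 ≤ ((tentMap^[i] x : unitInterval) : ℝ)} :=
    isClosed_le continuous_const (continuous_subtype_val.comp (continuous_tentMap.iterate i))
  convert this.measurableSet using 1
  ext x
  simp [tentItinerary]

/-- Invariant measures which agree on the fundamental intervals are equal. -/
theorem eq_of_forall_tentFundamentalInterval {μ ν : Measure unitInterval} [IsProbabilityMeasure μ]
    [IsProbabilityMeasure ν] (hμ : MeasurePreserving tentMap μ μ)
    (hν : MeasurePreserving tentMap ν ν)
    (h : ∀ w, μ (tentFundamentalInterval w) = ν (tentFundamentalInterval w)) : μ = ν := by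
  refine ext_of_forall_integral_eq_of_IsFiniteMeasure fun f => ?_
  -- `F K ∘ r K` approximates `f` by a function of the first `K` digits; the padding with `false` is
  -- arbitrary.
  let r : (K : ℕ) → unitInterval → Fin K → Bool := fun K x i => tentItinerary x i
  let F : (K : ℕ) → (Fin K → Bool) → ℝ := fun K w =>
    f (tentCode fun i => if h : i < K then w ⟨i, h⟩ else false)
  have hr : ∀ K, Measurable (r K) := fun K =>
    measurable_pi_lambda _ fun i => measurable_tentItinerary i
  have hF : ∀ K, Measurable (F K) := fun K => measurable_of_countable _
  have hmap : ∀ K, Measure.map (r K) μ = Measure.map (r K) ν := fun K => by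
    refine Measure.ext_of_singleton fun w => ?_
    rw [Measure.map_apply (hr K) (measurableSet_singleton w),
      Measure.map_apply (hr K) (measurableSet_singleton w)]
    change μ ((fun x (i : Fin K) => tentItinerary x i) ⁻¹' {w}) =
      ν ((fun x (i : Fin K) => tentItinerary x i) ⁻¹' {w})
    rw [measure_tentItinerary_preimage hμ, measure_tentItinerary_preimage hν, h]
  have hint : ∀ K, ∫ x, F K (r K x) ∂μ = ∫ x, F K (r K x) ∂ν := fun K => by
    rw [← integral_map (hr K).aemeasurable (hF K).aestronglyMeasurable,
      ← integral_map (hr K).aemeasurable (hF K).aestronglyMeasurable, hmap]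
  have hlim : ∀ x, Tendsto (fun K => F K (r K x)) atTop (𝓝 (f x)) := fun x => by
    refine (f.continuous.tendsto x).comp (tendsto_iff_dist_tendsto_zero.2 ?_)
    refine squeeze_zero (fun _ => dist_nonneg) (fun K => ?_)
      (tendsto_pow_atTop_nhds_zero_of_lt_one (by norm_num : (0 : ℝ) ≤ 1 / 2) (by norm_num))
    conv_lhs => rw [← tentCode_tentItinerary x]
    refine dist_tentCode_le fun i hi => ?_
    simp [r, hi, tentCode_tentItinerary]
  have key : ∀ ρ : Measure unitInterval, IsProbabilityMeasure ρ →
      Tendsto (fun K => ∫ x, F K (r K x) ∂ρ) atTop (𝓝 (∫ x, f x ∂ρ)) := fun ρ _ =>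
    tendsto_integral_of_dominated_convergence (fun _ => ‖f‖)
      (fun K => ((hF K).comp (hr K)).aestronglyMeasurable) (integrable_const _)
      (fun K => .of_forall fun x => f.norm_coe_le_norm _) (.of_forall hlim)
  exact tendsto_nhds_unique (key μ inferInstance)
    ((key ν inferInstance).congr fun K => (hint K).symm)

/-! ### Generic and regular points -/

/-- The empirical measures converge if the frequencies of all blocks do. -/
theorem exists_tendsto_empiricalMeasure_of_visitFrequency {x : unitInterval}
    (h : ∀ w : List Bool, ∃ c : ℝ,
      Tendsto (visitFrequency tentMap (tentFundamentalInterval w) x) atTop (𝓝 c)) :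
    ∃ ν : ProbabilityMeasure unitInterval, Tendsto (empiricalMeasure tentMap x) atTop (𝓝 ν) := by
  choose c hc using h
  -- All limit points are invariant and give block `w` the mass `c w`, so they coincide.
  have key : ∀ (u : Ultrafilter ℕ), ↑u ≤ (atTop : Filter ℕ) →
      ∀ ρ : ProbabilityMeasure unitInterval, Tendsto (empiricalMeasure tentMap x) u (𝓝 ρ) →
      MeasurePreserving tentMap (ρ : Measure unitInterval) (ρ : Measure unitInterval) ∧
      ∀ w, (ρ : Measure unitInterval).real (tentFundamentalInterval w) = c w := by
    intro u hu ρ hρ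
    have hinv := measurePreserving_of_tendsto_empiricalMeasure hu continuous_tentMap hρ
    exact ⟨hinv, fun w => tendsto_nhds_unique (tendsto_visitFrequency_of_tendsto_empiricalMeasure hρ
      (measure_frontier_tentFundamentalInterval hinv w))
      (((tendsto_add_atTop_iff_nat 1).2 (hc w)).mono_left hu)⟩
  obtain ⟨ν, hν⟩ := exists_tendsto_empiricalMeasure_ultrafilter (T := tentMap) (x := x)
    (Ultrafilter.of atTop)
  obtain ⟨h1, h2⟩ := key _ (Ultrafilter.of_le atTop) ν hν
  refine ⟨ν, (tendsto_iff_ultrafilter _ _ _).2 fun u hu => ?_⟩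
  obtain ⟨ρ, hρ⟩ := exists_tendsto_empiricalMeasure_ultrafilter (T := tentMap) (x := x) u
  obtain ⟨h3, h4⟩ := key u hu ρ hρ
  have : ρ = ν := by
    refine ProbabilityMeasure.toMeasure_injective (eq_of_forall_tentFundamentalInterval h3 h1 fun w => ?_)
    exact (measureReal_eq_measureReal_iff).1 ((h4 w).trans (h2 w).symm)
  exact this ▸ hρ

theorem generates_iff {μ : Measure unitInterval} [IsProbabilityMeasure μ]
    (hμ : MeasurePreserving tentMap μ μ) (x : unitInterval) :
    Generates tentMap μ x ↔ ∀ f : C(unitInterval, ℝ),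
      Tendsto (fun N => birkhoffAverage ℝ tentMap f N x) atTop (𝓝 (∫ y, f y ∂μ)) := by
  obtain ⟨P, rfl⟩ : ∃ P : ProbabilityMeasure unitInterval, (P : Measure unitInterval) = μ :=
    ⟨⟨μ, inferInstance⟩, rfl⟩
  have hiff : (∀ f : C(unitInterval, ℝ),
      Tendsto (fun N => birkhoffAverage ℝ tentMap f N x) atTop (𝓝 (∫ y, f y ∂(P : Measure unitInterval)))) ↔
      Tendsto (empiricalMeasure tentMap x) atTop
        (𝓝 P) := by
    rw [tendsto_empiricalMeasure_iff]
    exact forall_congr' fun f => (tendsto_add_atTop_iff_nat 1).symm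
  rw [hiff]
  constructor
  · intro h
    have hw : ∀ w, Tendsto (visitFrequency tentMap (tentFundamentalInterval w) x) atTop
        (𝓝 ((P : Measure unitInterval).real (tentFundamentalInterval w))) := fun w =>
      h _ (ordConnected_tentFundamentalInterval w) (measure_frontier_tentFundamentalInterval hμ w)
    obtain ⟨ν, hν⟩ := exists_tendsto_empiricalMeasure_of_visitFrequency fun w => ⟨_, hw w⟩
    have hinv := measurePreserving_of_tendsto_empiricalMeasure le_rfl continuous_tentMap hν
    have : ν = P := by
      refine ProbabilityMeasure.toMeasure_injective (eq_of_forall_tentFundamentalInterval hinv hμ fun w => ?_)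
      refine (measureReal_eq_measureReal_iff).1 (tendsto_nhds_unique
        (tendsto_visitFrequency_of_tendsto_empiricalMeasure hν
          (measure_frontier_tentFundamentalInterval hinv w))
        ((tendsto_add_atTop_iff_nat 1).2 (hw w)))
    exact this ▸ hν
  · intro h s _ hs
    exact (tendsto_add_atTop_iff_nat 1).1
      (tendsto_visitFrequency_of_tendsto_empiricalMeasure h hs)

/-- Both complements consist of the points whose empirical measures converge. -/
theorem irregularSet_tentMap_eq : irregularSet tentMap = tentIrregularExpansionSet := by
  ext x
  simp only [irregularSet, tentIrregularExpansionSet, Set.mem_ofPred_eq]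
  rw [← not_iff_not]
  push Not
  constructor
  · intro h w
    obtain ⟨ν, hν⟩ := exists_tendsto_empiricalMeasure h
    have hinv := measurePreserving_of_tendsto_empiricalMeasure le_rfl continuous_tentMap hν
    exact ⟨_, (tendsto_add_atTop_iff_nat 1).1 (tendsto_visitFrequency_of_tendsto_empiricalMeasure hν
      (measure_frontier_tentFundamentalInterval hinv w))⟩
  · intro h f
    obtain ⟨ν, hν⟩ := exists_tendsto_empiricalMeasure_of_visitFrequency h
    exact ⟨_, (tendsto_add_atTop_iff_nat 1).1 (tendsto_empiricalMeasure_iff.1 hν f)⟩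

/-! ### Time averages as functions of the observable -/

/-- The Cauchy criterion removes the quantifier over limits, so that convergence to an unknown limit
can be treated like convergence to a constant. -/
theorem exists_tendsto_iff_tendsto_sub {u : ℕ → ℝ} : (∃ c, Tendsto u atTop (𝓝 c)) ↔
    Tendsto (fun p : ℕ × ℕ => u p.1 - u p.2) atTop (𝓝 0) := by
  constructor
  · rintro ⟨c, hc⟩
    rw [← prod_atTop_atTop_eq]
    simpa using (hc.comp tendsto_fst).sub (hc.comp tendsto_snd)
  · intro hu
    refine cauchySeq_tendsto_of_complete (cauchySeq_iff_tendsto_dist_atTop_0.2 ?_)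
    simpa [Real.dist_eq] using hu.abs

section Averages

variable {X : Type*} [TopologicalSpace X] [CompactSpace X]

theorem dist_average_le (u : ℕ → X) (N : ℕ) (f g : C(X, ℝ)) :
    dist ((∑ n ∈ Finset.range N, f (u n)) / (N : ℝ)) ((∑ n ∈ Finset.range N, g (u n)) / (N : ℝ)) ≤
      dist f g := by
  rcases N.eq_zero_or_pos with rfl | hN
  · simp
  have hN' : (0 : ℝ) < N := by exact_mod_cast hN
  rw [Real.dist_eq, ← sub_div, abs_div, Nat.abs_cast, div_le_iff₀ hN', ← Finset.sum_sub_distrib]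
  calc |∑ n ∈ Finset.range N, (f (u n) - g (u n))|
      ≤ ∑ n ∈ Finset.range N, |f (u n) - g (u n)| := Finset.abs_sum_le_sum_abs _ _
    _ ≤ ∑ n ∈ Finset.range N, dist f g :=
        Finset.sum_le_sum fun n _ => ContinuousMap.dist_apply_le_dist (f := f) (g := g) (u n)
    _ = dist f g * N := by simp [mul_comm]

/-- Averages are 1-Lipschitz in the observable, uniformly in `N`. Testing on a dense sequence of
observables is therefore enough. -/
theorem isClosed_setOf_tendsto_average [MeasurableSpace X] [OpensMeasurableSpace X]
    (u : ℕ → X) (μ : Measure X) [IsFiniteMeasure μ] :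
    IsClosed {f : C(X, ℝ) | Tendsto (fun N : ℕ => (∑ n ∈ Finset.range N, f (u n)) / (N : ℝ)) atTop
      (𝓝 (∫ x, f x ∂μ))} := by
  have h : UniformEquicontinuous fun (N : ℕ) (f : C(X, ℝ)) =>
      (∑ n ∈ Finset.range N, f (u n)) / (N : ℝ) :=
    LipschitzWith.uniformEquicontinuous _ 1 fun N =>
      LipschitzWith.of_dist_le_mul fun f g => by simpa using dist_average_le u N f g
  refine h.equicontinuous.isClosed_setOfPred_tendsto ?_
  refine (LipschitzWith.of_dist_le_mul (K := (μ.real Set.univ).toNNReal) fun f g => ?_).continuous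
  have hint : ∀ f : C(X, ℝ), Integrable f μ := fun f =>
    (integrable_const ‖f‖).mono' f.continuous.measurable.aestronglyMeasurable
      (.of_forall f.norm_coe_le_norm)
  rw [dist_eq_norm, ← integral_sub (hint f) (hint g), Real.coe_toNNReal _ measureReal_nonneg,
    mul_comm, dist_eq_norm]
  exact norm_integral_le_of_norm_le_const (.of_forall (f - g).norm_coe_le_norm)

theorem isClosed_setOf_exists_tendsto_average (u : ℕ → X) :
    IsClosed {f : C(X, ℝ) | ∃ c : ℝ,
      Tendsto (fun N : ℕ => (∑ n ∈ Finset.range N, f (u n)) / (N : ℝ)) atTop (𝓝 c)} := by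
  have h : UniformEquicontinuous fun (p : ℕ × ℕ) (f : C(X, ℝ)) =>
      (∑ n ∈ Finset.range p.1, f (u n)) / (p.1 : ℝ) -
        (∑ n ∈ Finset.range p.2, f (u n)) / (p.2 : ℝ) :=
    LipschitzWith.uniformEquicontinuous _ 2 fun p =>
      LipschitzWith.of_dist_le_mul fun f g => by
        refine (dist_sub_sub_le _ _ _ _).trans ?_
        have h1 := dist_average_le u p.1 f g
        have h2 := dist_average_le u p.2 f g
        push_cast
        linarith
  simp only [exists_tendsto_iff_tendsto_sub]
  exact h.equicontinuous.isClosed_setOfPred_tendsto continuous_const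

end Averages

theorem birkhoffAverage_eq_div {X : Type*} (T : X → X) (f : X → ℝ) (N : ℕ) (x : X) :
    birkhoffAverage ℝ T f N x = (∑ n ∈ Finset.range N, f (T^[n] x)) / (N : ℝ) := by
  rw [birkhoffAverage, birkhoffSum, smul_eq_mul, inv_mul_eq_div]

/-! ### A feature map which determines weak convergence -/

/-- There is a continuous map to a Hilbert space whose time averages control those of all
continuous functions. -/
theorem exists_featureMap (X : Type*) [MetricSpace X] [CompactSpace X]
    [MeasurableSpace X] [BorelSpace X] :
    ∃ φ : C(X, lp (fun _ : ℕ => ℝ) 2), ∀ (μ : Measure X) [IsFiniteMeasure μ] (v : ℕ → X),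
      Tendsto (fun N : ℕ => (N : ℝ)⁻¹ • ∑ n ∈ Finset.range N, φ (v n)) atTop (𝓝 (∫ x, φ x ∂μ)) →
      ∀ f : C(X, ℝ), Tendsto (fun N : ℕ => (∑ n ∈ Finset.range N, f (v n)) / (N : ℝ)) atTop
        (𝓝 (∫ x, f x ∂μ)) := by
  let g : ℕ → C(X, ℝ) := TopologicalSpace.denseSeq C(X, ℝ)
  -- The weights make the series defining `φ` converge uniformly; pairing with `e i` recovers `g i`
  -- up to the factor `c i`.
  let c : ℕ → ℝ := fun i => (1 / 2) ^ i / (1 + ‖g i‖)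
  have hc : ∀ i, 0 < c i := fun i => by positivity
  let e : ℕ → lp (fun _ : ℕ => ℝ) 2 := fun i => lp.single 2 i (1 : ℝ)
  have hbound : ∀ i x, ‖(c i * g i x) • e i‖ ≤ (1 / 2 : ℝ) ^ i := fun i x => by
    have h1 : ‖e i‖ = 1 := by simp [e, lp.norm_single]
    rw [norm_smul, h1, mul_one, norm_mul, Real.norm_eq_abs, abs_of_pos (hc i)]
    have h2 := (g i).norm_coe_le_norm x
    calc c i * ‖g i x‖ ≤ c i * (1 + ‖g i‖) := by
          gcongr
          linarith
      _ = (1 / 2) ^ i := div_mul_cancel₀ _ (by positivity)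
  let φ : C(X, lp (fun _ : ℕ => ℝ) 2) := ⟨fun x => ∑' i, (c i * g i x) • e i,
    continuous_tsum (fun i => by fun_prop) summable_geometric_two hbound⟩
  have hφ : ∀ i x, inner ℝ (e i) (φ x) = c i * g i x := fun i x => by
    have hs : Summable fun j => (c j * g j x) • e j :=
      .of_norm_bounded summable_geometric_two fun j => hbound j x
    have h1 := (innerSL ℝ (e i)).map_tsum hs
    simp only [innerSL_apply_apply] at h1
    refine h1.trans ?_
    rw [tsum_eq_single i]
    · simp [e, inner_smul_right]
    · intro j hj
      simp [e, inner_smul_right, lp.inner_single_left, hj.symm]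
  refine ⟨φ, fun μ _ v hv f => ?_⟩
  have hint : Integrable φ μ := by
    refine (integrable_const ‖φ‖).mono' ?_ (.of_forall fun x => φ.norm_coe_le_norm x)
    exact φ.continuous.aestronglyMeasurable_of_compactSpace
  have hg : ∀ i, Tendsto (fun N : ℕ => (∑ n ∈ Finset.range N, g i (v n)) / (N : ℝ)) atTop
      (𝓝 (∫ x, g i x ∂μ)) := fun i => by
    have h1 := (((innerSL ℝ (e i)).continuous.tendsto _).comp hv).const_mul (c i)⁻¹
    have h2 : (c i)⁻¹ * innerSL ℝ (e i) (∫ x, φ x ∂μ) = ∫ x, g i x ∂μ := by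
      rw [innerSL_apply_apply, ← integral_inner hint, ← integral_const_mul]
      refine integral_congr_ae (.of_forall fun x => ?_)
      simp only [hφ]
      rw [inv_mul_cancel_left₀ (hc i).ne']
    rw [h2] at h1
    refine h1.congr fun N => ?_
    simp only [Function.comp_apply, innerSL_apply_apply, inner_smul_right, inner_sum, hφ,
      ← Finset.mul_sum]
    have := (hc i).ne'
    field_simp
  have hd := (isClosed_setOf_tendsto_average v μ).closure_subset_iff.2
    (Set.range_subset_iff.2 hg)
  exact hd ((TopologicalSpace.denseRange_denseSeq C(X, ℝ)) f)

/-! ### Greedy construction of a sequence with prescribed averages -/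

section Greedy

variable {X H : Type*} [TopologicalSpace X] [NormedAddCommGroup H] [InnerProductSpace ℝ H]

theorem norm_sq_le_cube_of_inner_nonpos {D S : ℕ → H} {C : ℝ} (h0 : D 0 = 0)
    (hD : ∀ J, D (J + 1) = D J + S J) (hin : ∀ J, inner ℝ (D J) (S J) ≤ 0)
    (hS : ∀ J, ‖S J‖ ≤ C * (2 * J + 1)) (J : ℕ) : ‖D J‖ ^ 2 ≤ 4 * C ^ 2 * (J : ℝ) ^ 3 := by
  induction J with
  | zero => simp [h0]
  | succ J ih =>
    have h1 : ‖S J‖ ^ 2 ≤ (C * (2 * J + 1)) ^ 2 := by gcongr; exact hS J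
    rw [hD, norm_add_sq_real]
    push_cast
    -- The slack `4 (J + 1)³ - 4 J³ - (2 J + 1)²`.
    have h2 : 0 ≤ C ^ 2 * (8 * (J : ℝ) ^ 2 + 8 * J + 3) := by positivity
    nlinarith [hin J]

theorem tendsto_natSqrt_atTop : Tendsto Nat.sqrt atTop atTop :=
  tendsto_atTop.2 fun b => (eventually_ge_atTop (b * b)).mono fun _ hn => Nat.le_sqrt.2 hn

/-- Time `n` lies in block `J = Nat.sqrt n`, of length `2 * J + 1`, at offset `n - J * J`. -/
theorem sum_range_succ_mul_self {M : Type*} [AddCommMonoid M] (F : ℕ → ℕ → M) (J : ℕ) :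
    ∑ n ∈ Finset.range ((J + 1) * (J + 1)), F (Nat.sqrt n) (n - Nat.sqrt n * Nat.sqrt n) =
      ∑ n ∈ Finset.range (J * J), F (Nat.sqrt n) (n - Nat.sqrt n * Nat.sqrt n) +
        ∑ i ∈ Finset.range (2 * J + 1), F J i := by
  rw [show (J + 1) * (J + 1) = J * J + (2 * J + 1) by ring, Finset.sum_range_add]
  congr 1
  refine Finset.sum_congr rfl fun i hi => ?_
  have hi' := Finset.mem_range.1 hi
  rw [Nat.sqrt_add_eq J (by lia), Nat.add_sub_cancel_left]

/-- For an observable of mean zero with values in a Hilbert space there are points, such that the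
averages along the concatenation of orbit pieces of increasing length starting there tend to
zero. -/
theorem exists_tendsto_average_blocks [CompactSpace X] {T : X → X} (ψ : C(X, H))
    (hψ : ∀ (D : H) (N : ℕ), ∃ x, inner ℝ D (∑ i ∈ Finset.range N, ψ (T^[i] x)) ≤ 0) :
    ∃ y : ℕ → X, Tendsto (fun N : ℕ => (N : ℝ)⁻¹ • ∑ n ∈ Finset.range N,
      ψ (T^[n - Nat.sqrt n * Nat.sqrt n] (y (Nat.sqrt n)))) atTop (𝓝 0) := by
  choose p hp using hψ
  let D : ℕ → H := fun J => Nat.rec 0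
    (fun J d => d + ∑ i ∈ Finset.range (2 * J + 1), ψ (T^[i] (p d (2 * J + 1)))) J
  let y : ℕ → X := fun J => p (D J) (2 * J + 1)
  let S : ℕ → H := fun J => ∑ i ∈ Finset.range (2 * J + 1), ψ (T^[i] (y J))
  have hnorm : ∀ (F : Finset ℕ) (z : ℕ → X), ‖∑ i ∈ F, ψ (z i)‖ ≤ ‖ψ‖ * F.card := fun F z => by
    refine (norm_sum_le_of_le F fun i _ => ψ.norm_coe_le_norm (z i)).trans ?_
    simp [mul_comm]
  have hD : ∀ J, ‖D J‖ ^ 2 ≤ 4 * ‖ψ‖ ^ 2 * (J : ℝ) ^ 3 :=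
    norm_sq_le_cube_of_inner_nonpos (S := S) rfl (fun J => rfl) (fun J => hp _ _) fun J => by
      simpa using hnorm (Finset.range (2 * J + 1)) fun i => T^[i] (y J)
  let v : ℕ → X := fun n => T^[n - Nat.sqrt n * Nat.sqrt n] (y (Nat.sqrt n))
  have hsum : ∀ J, ∑ n ∈ Finset.range (J * J), ψ (v n) = D J := by
    intro J
    induction J with
    | zero => simp [D]
    | succ J ih =>
      exact (sum_range_succ_mul_self (fun s i => ψ (T^[i] (y s))) J).trans (congrArg (· + S J) ih)
  have hN : ∀ N : ℕ, ‖∑ n ∈ Finset.range N, ψ (v n)‖ ^ 2 ≤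
      16 * ‖ψ‖ ^ 2 * (Nat.sqrt N : ℝ) ^ 3 := by
    intro N
    set J := Nat.sqrt N
    have h1 : J * J ≤ N := Nat.sqrt_le N
    have h2 : N ≤ J * J + J + J := Nat.sqrt_le_add N
    -- An unfinished block contributes at most `2 * J` terms, negligible against `J ^ (3 / 2)`.
    have h3 : ‖∑ n ∈ Finset.range N, ψ (v n)‖ ≤ ‖D J‖ + ‖ψ‖ * (2 * J) := by
      rw [← Finset.sum_range_add_sum_Ico _ h1, hsum]
      refine (norm_add_le _ _).trans ?_
      gcongr
      refine (hnorm _ _).trans ?_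
      gcongr
      rw [Nat.card_Ico]
      exact_mod_cast (by lia : N - J * J ≤ 2 * J)
    have h4 : (J : ℝ) ^ 2 ≤ (J : ℝ) ^ 3 := by
      exact_mod_cast (by
        rcases J.eq_zero_or_pos with h | h
        · simp [h]
        · exact Nat.pow_le_pow_right h (by norm_num) : J ^ 2 ≤ J ^ 3)
    have h5 : ‖ψ‖ ^ 2 * (J : ℝ) ^ 2 ≤ ‖ψ‖ ^ 2 * (J : ℝ) ^ 3 := by gcongr
    have h6 : ‖∑ n ∈ Finset.range N, ψ (v n)‖ ^ 2 ≤ (‖D J‖ + ‖ψ‖ * (2 * J)) ^ 2 := by gcongr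
    nlinarith [hD J, sq_nonneg (‖D J‖ - ‖ψ‖ * (2 * J))]
  refine ⟨y, ?_⟩
  rw [tendsto_zero_iff_norm_tendsto_zero]
  have h7 : Tendsto (fun N : ℕ => √(16 * ‖ψ‖ ^ 2 / (Nat.sqrt N : ℝ))) atTop (𝓝 0) := by
    have : Tendsto (fun N : ℕ => 16 * ‖ψ‖ ^ 2 / (Nat.sqrt N : ℝ)) atTop (𝓝 0) :=
      (tendsto_const_div_atTop_nhds_zero_nat _).comp tendsto_natSqrt_atTop
    simpa using this.sqrt
  refine squeeze_zero' (.of_forall fun _ => norm_nonneg _) ?_ h7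
  filter_upwards [eventually_ge_atTop 1] with N hN1
  have hJ : 0 < Nat.sqrt N := Nat.sqrt_pos.2 hN1
  have hJ' : (0 : ℝ) < Nat.sqrt N := by exact_mod_cast hJ
  have hNJ : (Nat.sqrt N : ℝ) ^ 2 ≤ N := by exact_mod_cast (sq (Nat.sqrt N)).le.trans (Nat.sqrt_le N)
  refine Real.le_sqrt_of_sq_le ?_
  rw [norm_smul, mul_pow, norm_inv, Real.norm_natCast, inv_pow, inv_mul_eq_div,
    div_le_div_iff₀ (by positivity) hJ']
  calc _ ≤ 16 * ‖ψ‖ ^ 2 * (Nat.sqrt N : ℝ) ^ 3 * Nat.sqrt N := by gcongr; exact hN N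
    _ = 16 * ‖ψ‖ ^ 2 * ((Nat.sqrt N : ℝ) ^ 2) ^ 2 := by ring
    _ ≤ _ := by gcongr

end Greedy

/-! ### Generic digit sequences -/

theorem dist_tentCode_shift_le {v w : ℕ → Bool} {n m : ℕ} (h : v n = w m) :
    dist (tentCode fun i => v (i + n)) (tentCode fun i => w (i + m)) ≤
      dist (tentCode fun i => v (i + (n + 1))) (tentCode fun i => w (i + (m + 1))) / 2 := by
  rw [dist_tentCode_of_head_eq (v := fun i => v (i + n)) (w := fun i => w (i + m)) (by simpa using h)]
  simp only [add_assoc, add_comm 1, le_refl]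

theorem iterate_tentMap_eq_tentCode (x : unitInterval) (n : ℕ) :
    tentMap^[n] x = tentCode fun i => tentItinerary x (i + n) := by
  conv_lhs => rw [← tentCode_tentItinerary x, iterate_tentMap_tentCode]

theorem tendsto_natSqrt_div_zero : Tendsto (fun N : ℕ => (Nat.sqrt N : ℝ) / N) atTop (𝓝 0) := by
  have h : Tendsto (fun N : ℕ => 1 / (Nat.sqrt N : ℝ)) atTop (𝓝 0) :=
    (tendsto_const_div_atTop_nhds_zero_nat 1).comp tendsto_natSqrt_atTop
  refine squeeze_zero' (.of_forall fun N => by positivity) ?_ h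
  filter_upwards [eventually_ge_atTop 1] with N hN
  have h1 : (0 : ℝ) < Nat.sqrt N := by exact_mod_cast Nat.sqrt_pos.2 hN
  have h2 : (0 : ℝ) < N := by exact_mod_cast hN
  rw [div_le_div_iff₀ h2 h1, one_mul]
  exact_mod_cast Nat.sqrt_le N

/-- Concatenating blocks of itineraries, one follows on average the orbit pieces of the points
they come from. -/
theorem exists_tendsto_average_dist_blocks (y : ℕ → unitInterval) : ∃ w : ℕ → Bool,
    Tendsto (fun N : ℕ => (∑ n ∈ Finset.range N, dist (tentCode fun i => w (i + n))
      (tentMap^[n - Nat.sqrt n * Nat.sqrt n] (y (Nat.sqrt n)))) / (N : ℝ)) atTop (𝓝 0) := by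
  let w : ℕ → Bool := fun n => tentItinerary (y (Nat.sqrt n)) (n - Nat.sqrt n * Nat.sqrt n)
  -- The error term is `1` at the last time of a block and `0` elsewhere; it telescopes to `Nat.sqrt
  -- N`.
  refine ⟨w, tendsto_average_zero_of_le_half (h := fun n => (Nat.sqrt (n + 1) : ℝ) - Nat.sqrt n)
    (fun n => dist_nonneg) (fun n => dist_le_one_unitInterval _ _) (fun n => ?_) ?_⟩
  · rcases (Nat.sqrt_le_sqrt n.le_succ).eq_or_lt with h | h
    · simp only [iterate_tentMap_eq_tentCode]
      rw [← h, sub_self, zero_add,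
        show n + 1 - Nat.sqrt n * Nat.sqrt n = n - Nat.sqrt n * Nat.sqrt n + 1 from
          Nat.sub_add_comm (Nat.sqrt_le n)]
      exact dist_tentCode_shift_le rfl
    · have h1 : (Nat.sqrt n : ℝ) + 1 ≤ Nat.sqrt (n + 1) := by exact_mod_cast h
      have h2 := dist_le_one_unitInterval (tentCode fun i => w (i + n))
        (tentMap^[n - Nat.sqrt n * Nat.sqrt n] (y (Nat.sqrt n)))
      have h3 := dist_nonneg (x := tentCode fun i => w (i + (n + 1)))
        (y := tentMap^[n + 1 - Nat.sqrt (n + 1) * Nat.sqrt (n + 1)] (y (Nat.sqrt (n + 1))))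
      linarith
  · simp only [Finset.sum_range_sub (fun n => (Nat.sqrt n : ℝ))]
    simpa using tendsto_natSqrt_div_zero

/-- Every invariant probability measure is generated by a digit sequence. -/
theorem exists_generic_digits {μ : Measure unitInterval} [IsProbabilityMeasure μ]
    (hμ : MeasurePreserving tentMap μ μ) : ∃ w : ℕ → Bool, ∀ f : C(unitInterval, ℝ),
      Tendsto (fun N : ℕ => (∑ n ∈ Finset.range N, f (tentCode fun i => w (i + n))) / (N : ℝ))
        atTop (𝓝 (∫ x, f x ∂μ)) := by
  obtain ⟨φ, hφ⟩ := exists_featureMap unitInterval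
  have hint : Integrable φ μ := by
    refine (integrable_const ‖φ‖).mono' ?_ (.of_forall fun x => φ.norm_coe_le_norm x)
    exact φ.continuous.aestronglyMeasurable_of_compactSpace
  set m := ∫ x, φ x ∂μ with hm
  let ψ : C(unitInterval, lp (fun _ : ℕ => ℝ) 2) := φ - ContinuousMap.const _ m
  have hψint : Integrable ψ μ := hint.sub (integrable_const m)
  have hψ0 : ∫ x, ψ x ∂μ = 0 := by
    change ∫ x, (φ x - m) ∂μ = 0
    rw [integral_sub hint (integrable_const m)]
    simp [hm]
  have hψi : ∀ i, Integrable (fun x => ψ (tentMap^[i] x)) μ := fun i =>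
    (hμ.iterate i).integrable_comp_of_integrable hψint
  have hψi0 : ∀ i, ∫ x, ψ (tentMap^[i] x) ∂μ = 0 := fun i => by
    rw [← hψ0]
    conv_rhs => rw [← (hμ.iterate i).map_eq]
    rw [integral_map (hμ.iterate i).aemeasurable]
    exact ψ.continuous.aestronglyMeasurable_of_compactSpace
  obtain ⟨y, hy⟩ := exists_tendsto_average_blocks (T := tentMap) ψ fun D N => by
    have h1 : Integrable (fun x => ∑ i ∈ Finset.range N, ψ (tentMap^[i] x)) μ :=
      integrable_finsetSum _ fun i _ => hψi i
    -- By invariance the function has integral zero, so somewhere it is nonpositive.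
    obtain ⟨x, hx⟩ := exists_le_integral (h1.const_inner (𝕜 := ℝ) D)
    refine ⟨x, hx.trans_eq ?_⟩
    rw [integral_inner h1, integral_finsetSum _ fun i _ => hψi i]
    simp [hψi0]
  have hy' : Tendsto (fun N : ℕ => (N : ℝ)⁻¹ • ∑ n ∈ Finset.range N,
      φ (tentMap^[n - Nat.sqrt n * Nat.sqrt n] (y (Nat.sqrt n)))) atTop (𝓝 m) := by
    have h1 := hy.add_const m
    rw [zero_add] at h1
    refine h1.congr' ?_
    filter_upwards [eventually_ge_atTop 1] with N hN
    have hN' : (N : ℝ) ≠ 0 := by exact_mod_cast (by lia : N ≠ 0)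
    simp only [ψ, ContinuousMap.sub_apply, ContinuousMap.const_apply, Finset.sum_sub_distrib,
      Finset.sum_const, Finset.card_range, smul_sub]
    rw [← Nat.cast_smul_eq_nsmul ℝ, inv_smul_smul₀ hN', sub_add_cancel]
  obtain ⟨w, hw⟩ := exists_tendsto_average_dist_blocks y
  refine ⟨w, fun f => ?_⟩
  have h1 := (tendsto_average_sub_of_tendsto_average_dist f hw).add (hφ μ _ hy' f)
  rw [zero_add] at h1
  refine h1.congr fun N => ?_
  rw [← add_div, ← Finset.sum_add_distrib]
  simp

/-! ### Sequences with averages controlled on blocks -/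

theorem tendsto_average_zero_of_dyadic {h : ℕ → ℝ} (h0 : ∀ n, 0 ≤ h n)
    (hh : ∀ ε > 0, ∀ᶠ n in atTop, ∑ j ∈ Finset.Ico (2 ^ n) (2 ^ (n + 1)), h j ≤ ε * 2 ^ n) :
    Tendsto (fun N : ℕ => (∑ j ∈ Finset.range N, h j) / (N : ℝ)) atTop (𝓝 0) := by
  have hmono : Monotone fun N => ∑ j ∈ Finset.range N, h j := fun a b hab =>
    Finset.sum_le_sum_of_subset_of_nonneg (Finset.range_mono hab) fun j _ _ => h0 j
  rw [Metric.tendsto_atTop]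
  intro ε hε
  obtain ⟨n₁, hn₁⟩ := eventually_atTop.1 (hh (ε / 4) (by positivity))
  set C := ∑ j ∈ Finset.range (2 ^ n₁), h j
  have hpow : ∀ n, ∑ j ∈ Finset.range (2 ^ n), h j ≤ ε / 4 * 2 ^ n + C := by
    intro n
    induction n with
    | zero =>
      have : ∑ j ∈ Finset.range (2 ^ 0), h j ≤ C :=
        hmono (Nat.pow_le_pow_right (by norm_num) (by simp))
      exact this.trans (le_add_of_nonneg_left (by positivity))
    | succ n ih =>
      rcases lt_or_ge n n₁ with hn | hn
      · have : ∑ j ∈ Finset.range (2 ^ (n + 1)), h j ≤ C :=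
          hmono (Nat.pow_le_pow_right (by norm_num) hn)
        linarith [show 0 ≤ ε / 4 * 2 ^ (n + 1) by positivity]
      · rw [← Finset.sum_range_add_sum_Ico _
          (Nat.pow_le_pow_right (by norm_num : 0 < 2) n.le_succ)]
        rw [pow_succ (2 : ℝ)]
        linarith [hn₁ n hn]
  obtain ⟨N₀, hN₀⟩ := exists_nat_gt (2 * C / ε)
  refine ⟨N₀ + 1, fun N hN => ?_⟩
  have hNpos : (0 : ℝ) < N := by exact_mod_cast (by lia : 0 < N)
  have hNN : (N₀ : ℝ) < N := by exact_mod_cast hN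
  have hC : 2 * C < N * ε := (div_lt_iff₀ hε).1 (hN₀.trans hNN)
  rw [Real.dist_eq, sub_zero, abs_of_nonneg
    (div_nonneg (Finset.sum_nonneg fun j _ => h0 j) N.cast_nonneg), div_lt_iff₀ hNpos]
  have h1 : N ≤ 2 ^ (Nat.log 2 N + 1) := (Nat.lt_pow_succ_log_self (by norm_num) N).le
  have h2 : (2 : ℝ) ^ (Nat.log 2 N) ≤ N := by exact_mod_cast Nat.pow_log_le_self 2 (by lia : N ≠ 0)
  have h3 := (hmono h1).trans (hpow _)
  rw [pow_succ (2 : ℝ)] at h3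
  have h4 : ε / 4 * (2 ^ Nat.log 2 N * 2) ≤ ε / 4 * (N * 2) := by gcongr
  simp only at h3
  linarith

/-- A sequence with bounded sums over arbitrarily late blocks of positive relative length can
only have the average zero. -/
theorem eq_zero_of_frequently_abs_sum_le {d : ℕ → ℝ} {l δ : ℝ} (hδ : 0 < δ)
    (hd : Tendsto (fun N : ℕ => (∑ j ∈ Finset.range N, d j) / (N : ℝ)) atTop (𝓝 l))
    (h : ∃ᶠ v : ℕ in atTop, ∃ u ≤ v, δ * v ≤ v - u ∧ |∑ j ∈ Finset.Ico u v, d j| ≤ 1) :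
    l = 0 := by
  by_contra hl
  have hl' : 0 < |l| := abs_pos.2 hl
  -- With this choice `|l| * (v - u)` is at least `4 * ε * v`, while the errors at `u` and `v` cost
  -- only `2 * ε * v` plus a constant.
  set ε := δ * |l| / 4 with hε
  have hεpos : 0 < ε := by positivity
  obtain ⟨N₀, hN₀⟩ := eventually_atTop.1 (Metric.tendsto_nhds.1 hd ε hεpos)
  let S : ℕ → ℝ := fun N => ∑ j ∈ Finset.range N, d j
  -- `C` covers small `N`, since `u` need not be large.
  let C := ∑ N ∈ Finset.range (N₀ + 1), |S N - l * N|
  have hC : 0 ≤ C := Finset.sum_nonneg fun _ _ => abs_nonneg _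
  have hS : ∀ N : ℕ, |S N - l * N| ≤ ε * N + C := fun N => by
    rcases lt_or_ge N (N₀ + 1) with hN | hN
    · have h1 : |S N - l * N| ≤ C :=
        Finset.single_le_sum (f := fun N : ℕ => |S N - l * N|) (fun _ _ => abs_nonneg _)
          (Finset.mem_range.2 hN)
      have : 0 ≤ ε * N := by positivity
      linarith
    · have hNpos : (0 : ℝ) < N := by exact_mod_cast (by lia : 0 < N)
      have h1 := hN₀ N (by lia)
      rw [Real.dist_eq, ← mul_lt_mul_iff_left₀ hNpos] at h1
      have h2 : |S N / N - l| * N = |S N - l * N| := by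
        rw [← abs_of_pos hNpos, ← abs_mul, abs_of_pos hNpos, sub_mul, div_mul_cancel₀ _ hNpos.ne']
      rw [← h2]
      linarith
  obtain ⟨V, hV⟩ := exists_nat_gt ((1 + 2 * C) / (2 * ε))
  obtain ⟨v, ⟨u, huv, hvu, hsum⟩, hv⟩ := (h.and_eventually (eventually_ge_atTop V)).exists
  have hv' : (V : ℝ) ≤ v := by exact_mod_cast hv
  have huv' : (u : ℝ) ≤ v := by exact_mod_cast huv
  rw [Finset.sum_Ico_eq_sub _ huv] at hsum
  have h1 : |l| * (v - u) ≤ 1 + |S v - l * v| + |S u - l * u| := by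
    have h2 : l * (v - u) = (S v - S u) - (S v - l * v) + (S u - l * u) := by ring
    rw [show |l| * ((v : ℝ) - u) = |l * (v - u)| by
      rw [abs_mul, abs_of_nonneg (sub_nonneg.2 huv')], h2]
    refine (abs_add_le _ _).trans (add_le_add ((abs_sub _ _).trans (add_le_add hsum le_rfl)) le_rfl)
  have h3 : |l| * (δ * v) ≤ |l| * (v - u) := by gcongr
  have h4 : ε * u ≤ ε * v := by gcongr
  have h5 : |l| * (δ * v) = 4 * ε * v := by rw [hε]; ring
  have h6 : 1 + 2 * C < v * (2 * ε) := (div_lt_iff₀ (by positivity)).1 (hV.trans_le hv')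
  linarith [hS v, hS u]

/-- Distances decay geometrically backwards from the end of the window, so its length does not
matter. -/
theorem sum_Ico_dist_tentCode_le {v w : ℕ → Bool} {a b : ℕ} (h : ∀ j, a ≤ j → j < b → v j = w j) :
    ∑ j ∈ Finset.Ico a b, dist (tentCode fun i => v (i + j)) (tentCode fun i => w (i + j)) ≤ 1 := by
  rw [Finset.sum_Ico_eq_sum_range]
  have := sum_range_le_of_le_half (N := b - a) (h := fun _ => 0)
    (e := fun k => dist (tentCode fun i => v (i + (a + k))) (tentCode fun i => w (i + (a + k))))
    (fun _ => dist_nonneg) (fun _ => dist_le_one_unitInterval _ _) (fun k hk => ?_)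
  · simpa using this
  · rw [zero_add]
    exact dist_tentCode_shift_le (h (a + k) (by lia) (by lia))

theorem abs_sum_Ico_tentCode_sub_le {v w : ℕ → Bool} {a b : ℕ}
    (h : ∀ j, a ≤ j → j < b → v j = w j) :
    |∑ j ∈ Finset.Ico a b, ((tentCode fun i => v (i + j) : ℝ) - tentCode fun i => w (i + j))| ≤ 1 :=
  (Finset.abs_sum_le_sum_abs _ _).trans (sum_Ico_dist_tentCode_le h)

/-! ### The reduction -/

/-- The part of the dyadic block of `j` that is overwritten for the parameter `a`. -/
def overwritten (a : ℕ → ℕ) (j : ℕ) : Prop :=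
  j < 2 ^ Nat.log 2 j + 2 ^ (Nat.log 2 j - (a (Nat.log 2 j) + 1))

open Classical in
/-- The digit sequence `w`, with the digit `c` written into the beginning of each dyadic block. -/
noncomputable def overwrite (c : Bool) (w : ℕ → Bool) (a : ℕ → ℕ) (j : ℕ) : Bool :=
  if overwritten a j then c else w j

theorem continuous_overwrite (c : Bool) (w : ℕ → Bool) : Continuous (overwrite c w) := by
  refine continuous_pi fun j => ?_
  have h : Continuous fun a : ℕ → ℕ => a (Nat.log 2 j) := continuous_apply _
  exact (continuous_of_discreteTopology (f := fun k : ℕ => overwrite c w (fun _ => k) j)).comp h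

open Classical in
theorem sum_Ico_overwritten_le (a : ℕ → ℕ) (n : ℕ) :
    ∑ j ∈ Finset.Ico (2 ^ n) (2 ^ (n + 1)), (if overwritten a j then (1 : ℝ) else 0) ≤
      2 ^ (n - (a n + 1)) := by
  rw [Finset.sum_boole]
  have h : (Finset.Ico (2 ^ n) (2 ^ (n + 1))).filter (overwritten a) ⊆
      Finset.Ico (2 ^ n) (2 ^ n + 2 ^ (n - (a n + 1))) := fun j hj => by
    obtain ⟨hj, hja⟩ := Finset.mem_filter.1 hj
    rw [Finset.mem_Ico] at hj
    have hlog : Nat.log 2 j = n := Nat.log_eq_of_pow_le_of_lt_pow hj.1 hj.2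
    rw [overwritten, hlog] at hja
    exact Finset.mem_Ico.2 ⟨hj.1, hja⟩
  have := Finset.card_le_card h
  rw [Nat.card_Ico, Nat.add_sub_cancel_left] at this
  exact_mod_cast this

theorem tendsto_average_overwrite_of_divergent {a : ℕ → ℕ} (ha : a ∈ divergentSequences) (c : Bool)
    (w : ℕ → Bool) (f : C(unitInterval, ℝ)) :
    Tendsto (fun N : ℕ => (∑ n ∈ Finset.range N, (f (tentCode fun i => overwrite c w a (i + n)) -
      f (tentCode fun i => w (i + n)))) / (N : ℝ)) atTop (𝓝 0) := by
  classical
  refine tendsto_average_sub_of_tendsto_average_dist f (tendsto_average_zero_of_le_half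
    (h := fun j => if overwritten a j then (1 : ℝ) else 0) (fun _ => dist_nonneg)
    (fun _ => dist_le_one_unitInterval _ _) (fun n => ?_) ?_)
  · by_cases hn : overwritten a n
    · rw [if_pos hn]
      exact (dist_le_one_unitInterval _ _).trans (le_add_of_nonneg_right (by positivity))
    · rw [if_neg hn, zero_add]
      exact dist_tentCode_shift_le (if_neg hn)
  · refine tendsto_average_zero_of_dyadic (fun j => by positivity) fun ε hε => ?_
    obtain ⟨k, hk⟩ := exists_pow_lt_of_lt_one hε (by norm_num : (1 / 2 : ℝ) < 1)
    filter_upwards [ha.eventually_ge_atTop k, eventually_ge_atTop k] with n hn hkn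
    refine (sum_Ico_overwritten_le a n).trans ?_
    calc (2 : ℝ) ^ (n - (a n + 1)) ≤ 2 ^ (n - k) :=
          pow_le_pow_right₀ (by norm_num) (by lia)
      _ = (1 / 2) ^ k * 2 ^ n := by
          rw [pow_sub₀ _ (by norm_num) hkn, one_div, inv_pow, mul_comm]
      _ ≤ ε * 2 ^ n := by gcongr

/-- If `a` does not diverge then the averages along the overwritten sequence do not converge. -/
theorem not_tendsto_average_overwrite {a : ℕ → ℕ} (ha : a ∉ divergentSequences) {c : Bool}
    {w : ℕ → Bool} {m : ℝ}
    (hw : Tendsto (fun N : ℕ => (∑ n ∈ Finset.range N, (tentCode fun i => w (i + n) : ℝ)) / (N : ℝ))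
      atTop (𝓝 m))
    (hm : m ≠ tentCode fun _ => c) (l : ℝ) :
    ¬ Tendsto (fun N : ℕ => (∑ n ∈ Finset.range N,
      (tentCode fun i => overwrite c w a (i + n) : ℝ)) / (N : ℝ)) atTop (𝓝 l) := by
  intro hl
  have h1 : l - m = 0 := by
    have hd := hl.sub hw
    simp only [← sub_div, ← Finset.sum_sub_distrib] at hd
    -- The window is the second half `[3 * 2 ^ k, 2 ^ (k + 2))` of a block, never overwritten
    -- because of the `+ 1` in `overwritten`.
    refine eq_zero_of_frequently_abs_sum_le (δ := 1 / 4) (by norm_num) hd ?_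
    refine ((tendsto_add_atTop_iff_nat 2).2 (tendsto_pow_atTop_atTop_of_one_lt
      (one_lt_two : 1 < 2))).frequently (Eventually.frequently (.of_forall fun k => ?_))
    have hk : (2 : ℕ) ^ (k + 2) = 4 * 2 ^ k := by ring
    refine ⟨3 * 2 ^ k, by lia, by rw [hk]; push_cast; linarith,
      abs_sum_Ico_tentCode_sub_le fun j hj hj' => if_neg ?_⟩
    have hlog : Nat.log 2 j = k + 1 :=
      Nat.log_eq_of_pow_le_of_lt_pow (by rw [pow_succ]; lia) hj'
    have hle : 2 ^ (k + 1 - (a (k + 1) + 1)) ≤ 2 ^ k := Nat.pow_le_pow_right (by norm_num) (by lia)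
    rw [overwritten, hlog, pow_succ]
    lia
  have h2 : l - (tentCode fun _ => c : ℝ) = 0 := by
    have hc : Tendsto (fun N : ℕ => (∑ n ∈ Finset.range N, (tentCode fun _ => c : ℝ)) / (N : ℝ))
        atTop (𝓝 (tentCode fun _ => c : ℝ)) := by
      refine tendsto_const_nhds.congr' ?_
      filter_upwards [eventually_ge_atTop 1] with N hN
      have hN' : (N : ℝ) ≠ 0 := by exact_mod_cast (by lia : N ≠ 0)
      simp [hN']
    have hd := hl.sub hc
    simp only [← sub_div, ← Finset.sum_sub_distrib] at hd
    obtain ⟨A, hA⟩ : ∃ A, ∃ᶠ n in atTop, a n < A := by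
      by_contra! H
      exact ha (tendsto_atTop.2 fun b => (H b).mono fun n hn => hn)
    -- When `a n < A ≤ n`, the overwritten part has length at least `2 ^ (n - A)` and ends by `2 ^
    -- (n + 1)`.
    refine eq_zero_of_frequently_abs_sum_le (δ := 1 / 2 ^ (A + 1)) (by positivity) hd ?_
    have hv : Tendsto (fun n => 2 ^ n + 2 ^ (n - (a n + 1))) atTop atTop :=
      tendsto_atTop_mono (fun n => Nat.le_add_right _ _)
        (tendsto_pow_atTop_atTop_of_one_lt (one_lt_two : 1 < 2))
    refine hv.frequently ((hA.and_eventually (eventually_ge_atTop A)).mono fun n ⟨hn, hAn⟩ => ?_)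
    refine ⟨2 ^ n, Nat.le_add_right _ _, ?_,
      abs_sum_Ico_tentCode_sub_le (w := fun _ => c) fun j hj hj' => if_pos ?_⟩
    · have h3 : (2 : ℝ) ^ (n - (a n + 1)) ≤ 2 ^ n := pow_le_pow_right₀ (by norm_num) (by lia)
      have h4 : (2 : ℝ) ^ n ≤ 2 ^ A * 2 ^ (n - (a n + 1)) := by
        rw [← pow_add]
        exact pow_le_pow_right₀ (by norm_num) (by lia)
      push_cast
      rw [one_div, inv_mul_le_iff₀ (by positivity), pow_succ]
      linarith
    · have hlog : Nat.log 2 j = n := by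
        refine Nat.log_eq_of_pow_le_of_lt_pow hj (hj'.trans_le ?_)
        have : 2 ^ (n - (a n + 1)) ≤ 2 ^ n := Nat.pow_le_pow_right (by norm_num) (by lia)
        rw [pow_succ]
        lia
      rw [overwritten, hlog]
      exact hj'
  exact hm (by linarith)

/-- The constant sequences code the fixed points `0` and `2/3`; `m` misses one of them. -/
theorem tentCode_const_ne (m : ℝ) : ∃ c : Bool, m ≠ tentCode fun _ => c := by
  have h0 : (tentCode fun _ => false : ℝ) = (tentCode fun _ => false : ℝ) / 2 :=
    congrArg Subtype.val (tentCode_eq fun _ => false)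
  have h1 : (tentCode fun _ => true : ℝ) = 1 - (tentCode fun _ => true : ℝ) / 2 :=
    congrArg Subtype.val (tentCode_eq fun _ => true)
  by_contra! H
  have h2 := H false
  have h3 := H true
  linarith

/-- A continuous map which takes the divergent sequences to points generating `μ`, and the other
sequences to irregular points. -/
theorem exists_reduction {μ : Measure unitInterval} [IsProbabilityMeasure μ]
    (hμ : MeasurePreserving tentMap μ μ) : ∃ F : (ℕ → ℕ) → unitInterval, Continuous F ∧
      (∀ a ∈ divergentSequences, ∀ f : C(unitInterval, ℝ),
        Tendsto (fun N => birkhoffAverage ℝ tentMap f N (F a)) atTop (𝓝 (∫ x, f x ∂μ))) ∧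
      ∀ a ∉ divergentSequences, F a ∈ irregularSet tentMap := by
  obtain ⟨w, hw⟩ := exists_generic_digits hμ
  let p : C(unitInterval, ℝ) := ⟨Subtype.val, continuous_subtype_val⟩
  obtain ⟨c, hc⟩ := tentCode_const_ne (∫ x, p x ∂μ)
  refine ⟨fun a => tentCode (overwrite c w a),
    continuous_tentCode.comp (continuous_overwrite c w), fun a ha f => ?_, fun a ha => ⟨p, ?_⟩⟩
  · have h1 := (tendsto_average_overwrite_of_divergent ha c w f).add (hw f)
    rw [zero_add] at h1
    refine h1.congr fun N => ?_
    rw [← add_div, ← Finset.sum_add_distrib, birkhoffAverage_eq_div]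
    simp [iterate_tentMap_tentCode]
  · rintro ⟨l, hl⟩
    refine not_tendsto_average_overwrite ha (hw p) hc l (hl.congr fun N => ?_)
    rw [birkhoffAverage_eq_div]
    simp only [iterate_tentMap_tentCode]
    rfl

/-! ### Borel complexity -/

section Borel

variable {X : Type*} [TopologicalSpace X]

theorem isSigmaZeroThree_iUnion_of_isGδ {ι : Type*} [Countable ι] [Nonempty ι] {A : ι → Set X}
    (hA : ∀ i, IsGδ (A i)) : IsSigmaZeroThree (⋃ i, A i) := by
  obtain ⟨e, he⟩ := exists_surjective_nat ι
  exact ⟨fun n => A (e n), fun n => hA _, (he.iUnion_comp A).symm⟩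

theorem isSigmaZeroThree_iUnion {ι : Type*} [Countable ι] [Nonempty ι] {A : ι → Set X}
    (hA : ∀ i, IsSigmaZeroThree (A i)) : IsSigmaZeroThree (⋃ i, A i) := by
  choose B hB hAB using hA
  have : ⋃ i, A i = ⋃ p : ι × ℕ, B p.1 p.2 := by
    rw [Set.iUnion_prod']
    exact Set.iUnion_congr hAB
  rw [this]
  exact isSigmaZeroThree_iUnion_of_isGδ fun p => hB p.1 p.2

/-- Failure means that for some `k` the error exceeds `1 / (k + 1)` beyond every index; the strict
inequality makes the inner sets open. Pairs serve as indices for the Cauchy criterion. -/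
theorem isSigmaZeroThree_setOf_not_tendsto {ι : Type*} [Countable ι] [Nonempty ι] [Preorder ι]
    [IsDirectedOrder ι] {g : ι → X → ℝ} (hg : ∀ i, Continuous (g i)) (c : ℝ) :
    IsSigmaZeroThree {x | ¬ Tendsto (fun i => g i x) atTop (𝓝 c)} := by
  have h : {x | ¬ Tendsto (fun i => g i x) atTop (𝓝 c)} =
      ⋃ k : ℕ, ⋂ i, ⋃ j ≥ i, {x | 1 / ((k : ℝ) + 1) < dist (g j x) c} := by
    ext x
    simp only [Set.mem_ofPred_eq, Set.mem_iUnion, Set.mem_iInter, exists_prop]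
    constructor
    · intro hx
      by_contra! H
      refine hx (Metric.tendsto_nhds.2 fun ε hε => ?_)
      obtain ⟨k, hk⟩ := exists_nat_one_div_lt hε
      obtain ⟨i, hi⟩ := H k
      exact (eventually_ge_atTop i).mono fun j hj => (hi j hj).trans_lt hk
    · rintro ⟨k, hk⟩ hx
      obtain ⟨i, hi⟩ := eventually_atTop.1
        (Metric.tendsto_nhds.1 hx (1 / ((k : ℝ) + 1)) (by positivity))
      obtain ⟨j, hj, hjk⟩ := hk i
      exact lt_asymm hjk (hi j hj)
  rw [h]
  refine isSigmaZeroThree_iUnion_of_isGδ fun k => .iInter_of_isOpen fun i => ?_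
  exact isOpen_biUnion fun j _ => isOpen_lt continuous_const ((hg j).dist continuous_const)

end Borel

/-! ### Complexity of the basins and of the irregular set -/

theorem continuous_birkhoffAverage_tentMap (f : C(unitInterval, ℝ)) (N : ℕ) :
    Continuous (birkhoffAverage ℝ tentMap f N) := by
  simp only [funext fun x => birkhoffAverage_eq_div tentMap f N x]
  exact (continuous_finsetSum _ fun n _ =>
    f.continuous.comp (continuous_tentMap.iterate n)).div_const _

theorem isPiZeroThree_statisticalBasin {μ : Measure unitInterval} [IsProbabilityMeasure μ]
    (hμ : MeasurePreserving tentMap μ μ) : IsPiZeroThree (statisticalBasin tentMap μ) := by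
  have h : (statisticalBasin tentMap μ)ᶜ = ⋃ i : ℕ, {x | ¬ Tendsto (fun N => birkhoffAverage ℝ
      tentMap (TopologicalSpace.denseSeq C(unitInterval, ℝ) i) N x) atTop
      (𝓝 (∫ y, TopologicalSpace.denseSeq C(unitInterval, ℝ) i y ∂μ))} := by
    ext x
    simp only [statisticalBasin, Set.mem_compl_iff, Set.mem_ofPred_eq, generates_iff hμ,
      Set.mem_iUnion, ← not_forall, birkhoffAverage_eq_div]
    refine not_congr ⟨fun h i => h _, fun h f => ?_⟩
    exact (isClosed_setOf_tendsto_average (fun n => tentMap^[n] x) μ).closure_subset_iff.2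
      (Set.range_subset_iff.2 h) (TopologicalSpace.denseRange_denseSeq _ f)
  rw [IsPiZeroThree, h]
  exact isSigmaZeroThree_iUnion fun i =>
    isSigmaZeroThree_setOf_not_tendsto (fun N => continuous_birkhoffAverage_tentMap _ N) _

theorem isSigmaZeroThree_irregularSet : IsSigmaZeroThree (irregularSet tentMap) := by
  have h : irregularSet tentMap = ⋃ i : ℕ, {x | ¬ Tendsto (fun p : ℕ × ℕ =>
      birkhoffAverage ℝ tentMap (TopologicalSpace.denseSeq C(unitInterval, ℝ) i) p.1 x -
      birkhoffAverage ℝ tentMap (TopologicalSpace.denseSeq C(unitInterval, ℝ) i) p.2 x) atTop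
      (𝓝 0)} := by
    ext x
    simp only [irregularSet, Set.mem_ofPred_eq, Set.mem_iUnion, ← not_forall]
    refine not_congr ⟨fun h i => exists_tendsto_iff_tendsto_sub.1 (h _), fun h f => ?_⟩
    have h' := fun i => (exists_tendsto_iff_tendsto_sub (u := fun N => birkhoffAverage ℝ tentMap
      (TopologicalSpace.denseSeq C(unitInterval, ℝ) i) N x)).2 (h i)
    simp only [birkhoffAverage_eq_div] at h' ⊢
    exact (isClosed_setOf_exists_tendsto_average fun n => tentMap^[n] x).closure_subset_iff.2
      (Set.range_subset_iff.2 h') (TopologicalSpace.denseRange_denseSeq _ f)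
  rw [h]
  refine isSigmaZeroThree_iUnion fun i => ?_
  let f := TopologicalSpace.denseSeq C(unitInterval, ℝ) i
  exact isSigmaZeroThree_setOf_not_tendsto (g := fun (p : ℕ × ℕ) x =>
    birkhoffAverage ℝ tentMap f p.1 x - birkhoffAverage ℝ tentMap f p.2 x) (fun p =>
    (continuous_birkhoffAverage_tentMap f p.1).sub (continuous_birkhoffAverage_tentMap f p.2)) 0

theorem isPiZeroThreeComplete_statisticalBasin {μ : Measure unitInterval} [IsProbabilityMeasure μ]
    (hμ : MeasurePreserving tentMap μ μ) : IsPiZeroThreeComplete (statisticalBasin tentMap μ) := by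
  refine ⟨isPiZeroThree_statisticalBasin hμ, fun h => ?_⟩
  obtain ⟨F, hF, hgen, hirr⟩ := exists_reduction hμ
  refine not_isSigmaZeroThree_divergentSequences ?_
  convert h.preimage hF using 1
  ext a
  refine ⟨fun ha => (generates_iff hμ _).2 (hgen a ha), fun ha => ?_⟩
  by_contra hna
  obtain ⟨f, hf⟩ := hirr a hna
  exact hf ⟨_, (generates_iff hμ _).1 ha f⟩

theorem measurePreserving_tentMap_dirac :
    MeasurePreserving tentMap (Measure.dirac 0) (Measure.dirac 0) :=
  ⟨continuous_tentMap.measurable, by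
    rw [Measure.map_dirac' continuous_tentMap.measurable, tentMap_zero]⟩

theorem isSigmaZeroThreeComplete_irregularSet :
    IsSigmaZeroThreeComplete (irregularSet tentMap) := by
  refine ⟨isSigmaZeroThree_irregularSet, fun h => ?_⟩
  -- Any invariant measure would do here.
  obtain ⟨F, hF, hgen, hirr⟩ := exists_reduction measurePreserving_tentMap_dirac
  refine not_isSigmaZeroThree_divergentSequences ?_
  convert IsSigmaZeroThree.preimage h hF using 1
  ext a
  refine ⟨fun ha ⟨f, hf⟩ => hf ⟨_, hgen a ha f⟩, fun ha => ?_⟩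
  by_contra hna
  exact ha (hirr a hna)

theorem mainTheorem10 :
    (∀ μ : Measure unitInterval, IsProbabilityMeasure μ → MeasurePreserving tentMap μ μ →
      IsPiZeroThreeComplete (statisticalBasin tentMap μ)) ∧
    (irregularSet tentMap = tentIrregularExpansionSet ∧
      IsSigmaZeroThreeComplete (irregularSet tentMap)) ∧
    (Continuous tentMap ∧
      MeasurePreserving tentMap (Measure.dirac 0) (Measure.dirac 0) ∧
      IsPiZeroThreeComplete (statisticalBasin tentMap (Measure.dirac (0 : unitInterval)))) :=
  ⟨fun _ _ hμ => isPiZeroThreeComplete_statisticalBasin hμ,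
    ⟨irregularSet_tentMap_eq, isSigmaZeroThreeComplete_irregularSet⟩,
    continuous_tentMap, measurePreserving_tentMap_dirac,
    isPiZeroThreeComplete_statisticalBasin measurePreserving_tentMap_dirac⟩
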